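/- Let $K$ be a field. A graph of Gelfand–Kirillov dimension three is a connected finite directed graph without sinks and sources whose Leavitt path algebra $L_K(E)$ has Gelfand–Kirillov dimension $3$ (this does not depend on $K$). In such a graph a source cycle is a cycle without entry, i.e. no edge outside the cycle has its range on the cycle, and a sink cycle is a cycle without exit, i.e. no edge outside the cycle has its source on the cycle. A trail is a path of positive length from a vertex on a source cycle to a vertex on a sink cycle that passes in between only through vertices lying on no source or sink cycle. The graph is in normal form if every trail is a single edge and, for each source cycle $C$, all trails starting on $C$ have the same source. Let $C_1^E,\dots,C_m^E$ and $D_1^E,\dots,D_n^E$ be an enumeration (without repetition) of the source cycles and of the sink cycles of a graph $E$ of Gelfand–Kirillov dimension three in normal form. Put $p_i^E=|C_i^E|$ and $q_j^E=|D_j^E|$, and index the vertices of $C_i^E$ by the integers modulo $p_i^E$ and those of $D_j^E$ by the integers modulo $q_j^E$, so that each edge of a cycle leads from the vertex of index $k$ to the vertex of index $k+1$. For $c\in\mathbb Z$ let $N^E_{(i,j)}(c)$ be the number of trails from $C_i^E$ to $D_j^E$ whose range has an index $l$ with $l\equiv c \pmod{\gcd(p_i^E,q_j^E)}$. For two such graphs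 $E$ and $F$ write $E\approx F$ if they have the same number $m$ of source cycles and the same number $n$ of sink cycles, and if for suitable enumerations of these cycles and indexings of their vertices there are integers $a_1,\dots,a_m,b_1,\dots,b_n$ such that $$p_i^E=p_i^F,\qquad q_j^E=q_j^F,\qquad N^E_{(i,j)}(c)=N^F_{(i,j)}(c+a_i+b_j)$$ for all $c\in\mathbb N$, $1\le i\le m$ and $1\le j\le n$. Two square matrices $A,B$ over $\mathbb N$ are strong shift equivalent, $A\sim_{SSE}B$, if there is a finite sequence of square matrices $A=A_0,A_1,\dots,A_\ell=B$ over $\mathbb N$ such that for each $k$ there are (rectangular) matrices $R,S$ over $\mathbb N$ with $A_{k-1}=RS$ and $A_k=SR$. **Theorem.** Let $E$ and $F$ be graphs of Gelfand–Kirillov dimension three in normal form, with adjacency matrices $A_E$ and $A_F$. Then $A_E\sim_{SSE}A_F$ if and only if $E\approx F$. -/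

import Mathlib

open Quiver

/-! ## Finite directed graphs, paths and cycles

A directed graph with vertex type `V` is a `Quiver V`; `v ⟶ w` is the type of edges with source `v`
and range `w`, and `Quiver.Path v w` is the type of paths from `v` to `w`. -/

namespace GraphDyn

/-- The edges of the graph, each together with its source and its range. -/
abbrev Arrow (V : Type*) [Quiver V] : Type _ := Σ v w : V, (v ⟶ w)

/-- There are neither sinks nor sources. -/
def IsEssential (V : Type*) [Quiver V] : Prop :=
  (∀ v : V, ∃ w : V, Nonempty (v ⟶ w)) ∧ (∀ w : V, ∃ v : V, Nonempty (v ⟶ w))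

/-- The underlying undirected graph is connected. -/
def IsWeaklyConnected (V : Type*) [Quiver V] : Prop :=
  Nonempty V ∧ Subsingleton (WeaklyConnectedComponent V)

/-- A cycle of length `p ≥ 1` whose vertices (pairwise distinct) are indexed by the integers
modulo `p`, in such a way that the `k`-th edge of the cycle leads from the vertex of index `k` to
the vertex of index `k + 1`. -/
structure IndexedCycle (V : Type*) [Quiver V] where
  length : ℕ
  length_pos : 0 < length
  vertex : ZMod length → V
  vertex_injective : Function.Injective vertex
  edge : ∀ k : ZMod length, vertex k ⟶ vertex (k + 1)

namespace IndexedCycle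

variable {V : Type*} [Quiver V]

/-- The `k`-th edge as an element of the set of all edges. -/
def arrow (c : IndexedCycle V) (k : ZMod c.length) : Arrow V :=
  ⟨c.vertex k, c.vertex (k + 1), c.edge k⟩

/-- The two indexed cycles are the same cycle of the graph, up to the choice of the vertex from
which the indices are counted. -/
def SameCycle (c d : IndexedCycle V) : Prop :=
  Set.range c.arrow = Set.range d.arrow

/-- A sink cycle is a cycle without exit: every edge whose source lies on the cycle is an edge of
the cycle. -/
def IsSinkCycle (c : IndexedCycle V) : Prop :=
  ∀ (k : ZMod c.length) (w : V) (f : c.vertex k ⟶ w),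
    (⟨c.vertex k, w, f⟩ : Arrow V) ∈ Set.range c.arrow

/-- A source cycle is a cycle without entry: every edge whose range lies on the cycle is an edge of
the cycle. -/
def IsSourceCycle (c : IndexedCycle V) : Prop :=
  ∀ (k : ZMod c.length) (v : V) (f : v ⟶ c.vertex k),
    (⟨v, c.vertex k, f⟩ : Arrow V) ∈ Set.range c.arrow

end IndexedCycle

section Trails

variable {V : Type*} [Quiver V]

/-- The vertex lies on some source cycle. -/
def OnSourceCycle (v : V) : Prop :=
  ∃ c : IndexedCycle V, c.IsSourceCycle ∧ v ∈ Set.range c.vertex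

/-- The vertex lies on some sink cycle. -/
def OnSinkCycle (v : V) : Prop :=
  ∃ c : IndexedCycle V, c.IsSinkCycle ∧ v ∈ Set.range c.vertex

/-- A trail is a path of positive length from a vertex on a source cycle to a vertex on a sink
cycle that passes in between only through vertices which are on no source or sink cycle. -/
def IsTrail {v w : V} (p : Path v w) : Prop :=
  0 < p.length ∧ OnSourceCycle v ∧ OnSinkCycle w ∧
    ∀ (u : V) (q : Path v u) (r : Path u w), p = q.comp r → 0 < q.length → 0 < r.length →
      ¬ OnSourceCycle u ∧ ¬ OnSinkCycle u

variable (V) in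
/-- Every trail consists of exactly one edge, and all trails which start on the same source cycle
start at the same vertex. -/
def IsNormalForm : Prop :=
  (∀ (v w : V) (p : Path v w), IsTrail p → p.length = 1) ∧
  ∀ c : IndexedCycle V, c.IsSourceCycle →
    ∀ (k k' : ZMod c.length) (w w' : V) (p : Path (c.vertex k) w) (p' : Path (c.vertex k') w'),
      IsTrail p → IsTrail p' → c.vertex k = c.vertex k'

end Trails

/-! ## Leavitt path algebras and Gelfand-Kirillov dimension -/

/-- Generators of the Leavitt path algebra: the vertices, the edges and the ghost edges. -/
inductive LeavittGen (V : Type*) [Quiver V]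
  | vertex (v : V) : LeavittGen V
  | edge (e : Arrow V) : LeavittGen V
  | ghost (e : Arrow V) : LeavittGen V

section Leavitt

variable (K : Type*) [Field K] (V : Type*) [Quiver V] [Fintype V] [∀ v w : V, Fintype (v ⟶ w)]

/-- The vertex `v` as an element of the free algebra. -/
abbrev genV (v : V) : FreeAlgebra K (LeavittGen V) := FreeAlgebra.ι K (LeavittGen.vertex v)

/-- The edge `e` as an element of the free algebra. -/
abbrev genE (e : Arrow V) : FreeAlgebra K (LeavittGen V) := FreeAlgebra.ι K (LeavittGen.edge e)

/-- The ghost edge `e*` as an element of the free algebra. -/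
abbrev genG (e : Arrow V) : FreeAlgebra K (LeavittGen V) := FreeAlgebra.ι K (LeavittGen.ghost e)

/-- The defining relations of the Leavitt path algebra of a finite graph. The last one says that
the unit of the algebra is the sum of all vertices; it is needed since the free algebra carries
a unit of its own. -/
inductive LeavittRel : FreeAlgebra K (LeavittGen V) → FreeAlgebra K (LeavittGen V) → Prop
  | vertex_mul_self (v : V) : LeavittRel (genV K V v * genV K V v) (genV K V v)
  | vertex_mul_of_ne (v w : V) : v ≠ w → LeavittRel (genV K V v * genV K V w) 0
  | source_mul (e : Arrow V) : LeavittRel (genV K V e.1 * genE K V e) (genE K V e)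
  | mul_range (e : Arrow V) : LeavittRel (genE K V e * genV K V e.2.1) (genE K V e)
  | ghost_mul_source (e : Arrow V) : LeavittRel (genG K V e * genV K V e.1) (genG K V e)
  | range_mul_ghost (e : Arrow V) : LeavittRel (genV K V e.2.1 * genG K V e) (genG K V e)
  | ghost_mul_self (e : Arrow V) : LeavittRel (genG K V e * genE K V e) (genV K V e.2.1)
  | ghost_mul_of_ne (e f : Arrow V) : e ≠ f → LeavittRel (genG K V e * genE K V f) 0
  | vertex_eq_sum (v : V) : (∃ w : V, Nonempty (v ⟶ w)) →
      LeavittRel (genV K V v) (∑ w : V, ∑ f : v ⟶ w, genE K V ⟨v, w, f⟩ * genG K V ⟨v, w, f⟩)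
  | sum_vertex : LeavittRel (∑ v : V, genV K V v) 1

/-- The Leavitt path algebra of a finite graph with coefficients in `K`. -/
abbrev LeavittPathAlgebra : Type _ := RingQuot (LeavittRel K V)

end Leavitt

/-- The Gelfand-Kirillov dimension of a unital `K`-algebra `A`: the supremum, over all finite
dimensional subspaces `W`, of the limsup of `log_n dim (K·1 + W)^n`. If `A` is finitely generated,
any `W` that generates `A` attains this supremum. -/
noncomputable def gkDim (K A : Type*) [Field K] [Ring A] [Algebra K A] : EReal :=
  ⨆ (W : Submodule K A) (_ : W.FG),
    Filter.limsup
      (fun n : ℕ => ((Real.logb n (Module.finrank K ↥((1 ⊔ W) ^ n : Submodule K A)) : ℝ) : EReal))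
      Filter.atTop

/-- A connected finite essential graph whose Leavitt path algebra over `K` has Gelfand-Kirillov
dimension three. -/
def IsGKDimThree (K : Type*) [Field K] (V : Type*) [Quiver V] [Fintype V]
    [∀ v w : V, Fintype (v ⟶ w)] : Prop :=
  IsWeaklyConnected V ∧ IsEssential V ∧ gkDim K (LeavittPathAlgebra K V) = 3

/-! ## Strong shift equivalence -/

/-- The adjacency matrix: the `(v, w)` entry is the number of edges from `v` to `w`. -/
def adjMatrix (V : Type*) [Quiver V] [∀ v w : V, Fintype (v ⟶ w)] : Matrix V V ℕ :=
  Matrix.of fun v w => Fintype.card (v ⟶ w)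

/-- Elementary (strong shift) equivalence of square nonnegative integer matrices. -/
def ElemEquiv {ι κ : Type*} [Fintype ι] [Fintype κ] (A : Matrix ι ι ℕ) (B : Matrix κ κ ℕ) : Prop :=
  ∃ (R : Matrix ι κ ℕ) (S : Matrix κ ι ℕ), A = R * S ∧ B = S * R

/-- Elementary equivalence of matrices of possibly different sizes. -/
def ElemStep (X Y : Σ n : ℕ, Matrix (Fin n) (Fin n) ℕ) : Prop := ElemEquiv X.2 Y.2

/-- Strong shift equivalence: a finite chain of elementary equivalences leads from `A` to `B`. The
intermediate matrices have index sets `Fin n`, which is no restriction since matrices that differ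
by a relabelling of the index set are elementary equivalent. -/
def StrongShiftEquiv {ι κ : Type*} [Fintype ι] [Fintype κ]
    (A : Matrix ι ι ℕ) (B : Matrix κ κ ℕ) : Prop :=
  ∃ X Y : (Σ n : ℕ, Matrix (Fin n) (Fin n) ℕ),
    ElemEquiv A X.2 ∧ Relation.ReflTransGen ElemStep X Y ∧ ElemEquiv Y.2 B

/-! ## Pointed graphs and the relation `≈` -/

/-- An enumeration `C 0, …, C (m-1)` of the source cycles and `D 0, …, D (n-1)` of the sink cycles
of a graph, each cycle listed exactly once, with indices chosen for the vertices on each of them. -/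
structure Pointing (V : Type*) [Quiver V] (m n : ℕ) where
  C : Fin m → IndexedCycle V
  D : Fin n → IndexedCycle V
  source_C : ∀ i, (C i).IsSourceCycle
  sink_D : ∀ j, (D j).IsSinkCycle
  existsUnique_C : ∀ c : IndexedCycle V, c.IsSourceCycle → ∃! i, c.SameCycle (C i)
  existsUnique_D : ∀ c : IndexedCycle V, c.IsSinkCycle → ∃! j, c.SameCycle (D j)

/-- `P.N i j c` is the number of trails from the `i`-th source cycle to the `j`-th sink cycle whose
range has an index congruent to `c` modulo the greatest common divisor of the two cycle lengths. -/
noncomputable def Pointing.N {V : Type*} [Quiver V] {m n : ℕ} (P : Pointing V m n)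
    (i : Fin m) (j : Fin n) (c : ℤ) : ℕ :=
  Nat.card {x : Σ (k : ZMod (P.C i).length) (l : ZMod (P.D j).length),
      Path ((P.C i).vertex k) ((P.D j).vertex l) //
    IsTrail x.2.2 ∧ (x.2.1.val : ℤ) ≡ c [ZMOD (Nat.gcd (P.C i).length (P.D j).length : ℕ)]}

/-- The relation `E ≈ F`: for suitable enumerations of the source and sink cycles of both graphs
the cycle lengths agree, and the trail counts agree up to shifts `a i + b j` of the index. -/
def Approx (E F : Type*) [Quiver E] [Quiver F] : Prop :=
  ∃ (m n : ℕ) (P : Pointing E m n) (Q : Pointing F m n) (a : Fin m → ℤ) (b : Fin n → ℤ),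
    (∀ i, (P.C i).length = (Q.C i).length) ∧ (∀ j, (P.D j).length = (Q.D j).length) ∧
    ∀ (c : ℕ) (i : Fin m) (j : Fin n), P.N i j c = Q.N i j (c + a i + b j)

end GraphDyn

/-!
# Strong shift equivalence of graphs of Gelfand-Kirillov dimension three in normal form

The Gelfand-Kirillov dimension enters through two estimates. If two different edges with the same
source both lie on closed paths, then the Leavitt path algebra contains a linearly independent
family `x^i a y^j (y*)^l a* (x*)^k` of quartic growth, so that its dimension exceeds three
(`three_lt_gkDim_of_paths`); for a single loop the dimension is less than three
(`gkDim_lt_three_of_loop`). Hence different cycles are disjoint, and no cycle is both a source cycle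
and a sink cycle: by connectedness it would be the whole graph, and normal form would make it a
loop. A shortest path from a source cycle to a sink cycle through a vertex on neither would be a
trail of length at least two, so in normal form every vertex lies on exactly one of these cycles.
The adjacency matrix is therefore `A = Z + T`, where `Z` is the matrix of the permutation `σ` which
moves each vertex one step along its cycle, and `T` counts the trails (`CyclicStructure`).

For a common period `L > 0` of the cycles put `Ω(u, v) = ∑ n < L, T(σⁿ u, σⁿ v)`. The theorem
compares both relations with the existence of a bijection of the vertices which commutes with the
permutations, preserves the types of the cycles and matches `Ω` (`OrbitMatch`).

* *Strong shift equivalence gives a matching.* A chain of elementary equivalences composes to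
  matrices `R` and `S` with `A R = R B`, `R S = A^L` and `S R = B^L`. Since `T Z^k T = 0`, the
  matrix `A^L` is the identity plus the block with entries `Ω(u, σ v)`. As the diagonal entries of
  `R S` and `S R` are `1` and everything is nonnegative, `R` contains exactly one permutation
  matrix supported on the pairs `(u, x)` with `R u x` and `S x u` both nonzero; all other nonzero
  entries of `R` lie in the block from source cycles to sink cycles, and `A^L R = R B^L` then says
  that the blocks of `A^L` and `B^L` agree (`exists_orbitMatch_of_strongShiftEquiv`).
* *A matching gives strong shift equivalence.* From `(1 + Y) (Z + W) = Z + W + Y Z` and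
  `(Z + W) (1 + Y) = Z + W + Z Y`, a single trail from `u` to `v` may be replaced by one from
  `σ u` to `σ v` (`elemEquiv_single_step`). Two trail matrices with the same `Ω` are joined by
  such moves (`reflTransGen_of_orbitSum_eq`).
* *A matching is the same as `E ≈ F`.* For `u` of index `z` on a source cycle of length `p` with
  base point `s`, and `v` of index `w` on a sink cycle of length `q`, the Chinese remainder
  theorem gives `Ω(u, v) = κ N(w - z + s)`, where `κ > 0` depends on `p`, `q` and `L` only
  (`CyclicStructure.orbitSum_eq_mul_N`). A matching shifts the indices on each cycle by a
  constant.
-/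

namespace GraphDyn

/-! ### A family of linearly independent products of partial isometries -/

section ToeplitzFamily

variable {A : Type*} [Ring A]

theorem star_pow_mul_pow {x xs v : A} (hx : xs * x = v) (hv : v * x = x) {a : A} (ha : v * a = a)
    (m n : ℕ) : xs ^ m * (x ^ (m + n) * a) = x ^ n * a := by
  induction m with
  | zero => simp
  | succ m ih =>
    have h : v * (x ^ (m + n) * a) = x ^ (m + n) * a := by
      cases h : m + n with
      | zero => simpa using ha
      | succ k => rw [pow_succ', mul_assoc, ← mul_assoc v, hv]
    rw [pow_succ, show m + 1 + n = (m + n) + 1 by ring, pow_succ', mul_assoc, mul_assoc x,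
      ← mul_assoc xs, hx, h, ih]

theorem star_pow_mul_pow_of_lt {x xs v : A} (hx : xs * x = v) (hv : v * x = x) {a : A}
    (ha : v * a = a) (hxa : xs * a = 0) {m n : ℕ} (h : n < m) : xs ^ m * (x ^ n * a) = 0 := by
  obtain ⟨k, rfl⟩ : ∃ k, m = k + 1 + n := ⟨m - n - 1, by omega⟩
  rw [pow_add, mul_assoc]
  have := star_pow_mul_pow hx hv ha n 0
  rw [add_zero, pow_zero, one_mul] at this
  rw [this, pow_succ, mul_assoc, hxa, mul_zero]

theorem star_mul_star_pow_mul_pow {x xs v a as w : A} (hx : xs * x = v) (hv : v * x = x)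
    (ha : v * a = a) (hxa : xs * a = 0) (hax : as * x = 0) (haa : as * a = w) (m n : ℕ) :
    as * (xs ^ m * (x ^ n * a)) = if m = n then w else 0 := by
  rcases lt_or_ge n m with h | h
  · rw [star_pow_mul_pow_of_lt hx hv ha hxa h, mul_zero, if_neg (by omega)]
  · obtain ⟨k, rfl⟩ := Nat.exists_eq_add_of_le h
    rw [star_pow_mul_pow hx hv ha]
    cases k with
    | zero => simp [haa]
    | succ k => rw [pow_succ', mul_assoc, ← mul_assoc, hax, zero_mul, if_neg (by omega)]

/-- Two partial isometries `x` and `y` (with adjoints `xs` and `ys`) which are joined by a partial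
isometry `a` orthogonal to `x`, such that `y` leaves room for a nonzero partial isometry `b`
orthogonal to it. The coordinates of the vector indexed by `(i, j, k, l)` can be recovered by
multiplying from both sides, up to terms with smaller `l`. -/
theorem linearIndependent_toeplitz (K : Type*) [Field K] [Algebra K A]
    {x xs a as y ys b bs v w z : A}
    (hx : xs * x = v) (hvx : v * x = x) (hva : v * a = a)
    (hxa : xs * a = 0) (hax : as * x = 0) (haa : as * a = w)
    (hy : ys * y = w) (hwy : w * y = y) (hwb : w * b = b)
    (hyb : ys * b = 0) (hby : bs * y = 0) (hbb : bs * b = z) (hz : z ≠ 0) :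
    LinearIndependent K (fun t : ℕ × ℕ × ℕ × ℕ =>
      x ^ t.1 * a * (y ^ t.2.1 * ys ^ t.2.2.2) * (as * xs ^ t.2.2.1)) := by
  have hwyb : ∀ n, w * (y ^ n * b) = y ^ n * b := by
    intro n
    cases n with
    | zero => simpa using hwb
    | succ n => rw [pow_succ', mul_assoc, ← mul_assoc w, hwy]
  -- the coordinate `(I, J, K', L)` is read off by multiplication from both sides
  have key : ∀ i j k l I J K' L : ℕ,
      (bs * ys ^ J * (as * xs ^ I)) * (x ^ i * a * (y ^ j * ys ^ l) * (as * xs ^ k)) *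
        (x ^ K' * a * (y ^ L * b)) =
      if I = i ∧ k = K' ∧ l ≤ L ∧ j + (L - l) = J then z else 0 := by
    intro i j k l I J K' L
    have e : (bs * ys ^ J * (as * xs ^ I)) * (x ^ i * a * (y ^ j * ys ^ l) * (as * xs ^ k)) *
        (x ^ K' * a * (y ^ L * b)) =
        bs * (ys ^ J * ((as * (xs ^ I * (x ^ i * a))) * (y ^ j * (ys ^ l *
          ((as * (xs ^ k * (x ^ K' * a))) * (y ^ L * b)))))) := by
      simp only [mul_assoc]
    rw [e, star_mul_star_pow_mul_pow hx hvx hva hxa hax haa,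
      star_mul_star_pow_mul_pow hx hvx hva hxa hax haa]
    by_cases h1 : I = i
    · by_cases h2 : k = K'
      · by_cases h3 : l ≤ L
        · obtain ⟨n, rfl⟩ := Nat.exists_eq_add_of_le h3
          rw [if_pos h1, if_pos h2, hwyb, star_pow_mul_pow hy hwy hwb, ← mul_assoc (y ^ j),
            ← pow_add, hwyb, star_mul_star_pow_mul_pow hy hwy hwb hyb hby hbb]
          simp [h1, h2, eq_comm]
        · rw [if_pos h1, if_pos h2, hwyb, star_pow_mul_pow_of_lt hy hwy hwb hyb (by omega)]
          simp [h3]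
      · simp [h2]
    · simp [h1]
  rw [linearIndependent_iff']
  intro s g hg
  have hsum : ∀ I J K' L : ℕ, ∑ t ∈ s, g t •
      (if I = t.1 ∧ t.2.2.1 = K' ∧ t.2.2.2 ≤ L ∧ t.2.1 + (L - t.2.2.2) = J then z else 0) = 0 := by
    intro I J K' L
    have h := congrArg (fun c => (bs * ys ^ J * (as * xs ^ I)) * c * (x ^ K' * a * (y ^ L * b))) hg
    simp only [Finset.mul_sum, Finset.sum_mul, mul_zero, zero_mul, mul_smul_comm, smul_mul_assoc,
      key] at h
    exact h
  suffices H : ∀ L I J K', (I, J, K', L) ∈ s → g (I, J, K', L) = 0 from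
    fun ⟨I, J, K', L⟩ h => H L I J K' h
  intro L
  induction L using Nat.strong_induction_on with
  | _ L ih =>
    intro I J K' hmem
    have h := hsum I J K' L
    rw [Finset.sum_eq_single_of_mem _ hmem] at h
    · simpa [hz] using h
    · rintro ⟨i, j, k, l⟩ ht hne
      split_ifs with hc
      · simp only at hc
        obtain ⟨rfl, rfl, h3, h4⟩ := hc
        rcases h3.lt_or_eq with h5 | rfl
        · rw [ih l h5 _ _ _ ht, zero_smul]
        · exact absurd (by simp_all) hne
      · simp

end ToeplitzFamily

/-! ### Quartic growth -/

section Growth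

variable {K A : Type*} [Field K] [Ring A] [Algebra K A]

/-- Quartic growth of one finitely generated subspace forces the Gelfand-Kirillov dimension to
exceed three. -/
theorem three_lt_gkDim_of_growth (W : Submodule K A) (hW : W.FG)
    (h : ∀ n : ℕ, n ^ 4 ≤ Module.finrank K ↥((1 ⊔ W) ^ (4 * n + 2) : Submodule K A)) :
    3 < gkDim K A := by
  -- any exponent strictly between `3` and `4` would do in place of `7 / 2`
  have h72 : (3 : EReal) < ((7 / 2 : ℝ) : EReal) := by
    have : ((3 : ℝ) : EReal) < ((7 / 2 : ℝ) : EReal) := by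
      rw [EReal.coe_lt_coe_iff]; norm_num
    exact this
  refine lt_of_lt_of_le h72 ?_
  unfold gkDim
  refine le_iSup₂_of_le W hW ?_
  refine Filter.le_limsup_of_frequently_le ?_
  rw [Filter.frequently_atTop]
  intro N
  set n := N + 6 ^ 7 with hn
  refine ⟨4 * n + 2, by omega, ?_⟩
  rw [EReal.coe_le_coe_iff]
  have hn1 : (6 : ℝ) ^ 7 ≤ n := by rw [hn]; push_cast; linarith [N.cast_nonneg (α := ℝ)]
  have hn0 : (0 : ℝ) < n := lt_of_lt_of_le (by norm_num) hn1
  have hb : (1 : ℝ) < ((4 * n + 2 : ℕ) : ℝ) := by push_cast; linarith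
  have hfin : ((n : ℝ)) ^ 4 ≤
      (Module.finrank K ↥((1 ⊔ W) ^ (4 * n + 2) : Submodule K A) : ℝ) := by
    exact_mod_cast h n
  rw [Real.le_logb_iff_rpow_le hb (lt_of_lt_of_le (by positivity) hfin)]
  refine le_trans ?_ hfin
  -- `(4n+2)^7 ≤ (6n)^7 ≤ n^8` once `n ≥ 6^7`; then take square roots
  have h7 : ((4 * n + 2 : ℕ) : ℝ) ^ 7 ≤ ((n : ℝ) ^ 4) ^ 2 := by
    have h6 : ((4 * n + 2 : ℕ) : ℝ) ≤ 6 * n := by push_cast; linarith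
    calc ((4 * n + 2 : ℕ) : ℝ) ^ 7 ≤ (6 * (n : ℝ)) ^ 7 := by gcongr
      _ = 6 ^ 7 * (n : ℝ) ^ 7 := by ring
      _ ≤ n * (n : ℝ) ^ 7 := by gcongr
      _ = _ := by ring
  have hpos : (0 : ℝ) ≤ ((4 * n + 2 : ℕ) : ℝ) := by positivity
  have : (((4 * n + 2 : ℕ) : ℝ) ^ (7 / 2 : ℝ)) ^ 2 ≤ ((n : ℝ) ^ 4) ^ 2 := by
    rw [← Real.rpow_natCast, ← Real.rpow_mul hpos]
    norm_num
    have := h7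
    push_cast at this
    convert this using 1
  exact le_of_sq_le_sq this (by positivity)

/-- The products in `linearIndependent_toeplitz` with all four exponents below `n` lie in the power
`4 * n + 2` of the subspace spanned by the factors and `1`. -/
theorem three_lt_gkDim_of_toeplitz
    {x xs a as y ys b bs v w z : A}
    (hx : xs * x = v) (hvx : v * x = x) (hva : v * a = a)
    (hxa : xs * a = 0) (hax : as * x = 0) (haa : as * a = w)
    (hy : ys * y = w) (hwy : w * y = y) (hwb : w * b = b)
    (hyb : ys * b = 0) (hby : bs * y = 0) (hbb : bs * b = z) (hz : z ≠ 0) :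
    3 < gkDim K A := by
  have hli := linearIndependent_toeplitz K hx hvx hva hxa hax haa hy hwy hwb hyb hby hbb hz
  have hWfg : (Submodule.span K ({x, xs, a, as, y, ys} : Set A)).FG :=
    Submodule.fg_span (Set.toFinite _)
  refine three_lt_gkDim_of_growth (Submodule.span K ({x, xs, a, as, y, ys} : Set A)) hWfg ?_
  intro n
  set U : Submodule K A := 1 ⊔ Submodule.span K ({x, xs, a, as, y, ys} : Set A) with hU
  have hUfg : U.FG := Submodule.FG.sup
    (Submodule.one_eq_span (R := K) (A := A) ▸ Submodule.fg_span_singleton 1) hWfg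
  have : Module.Finite K ↥(U ^ (4 * n + 2)) := Module.Finite.iff_fg.mpr (hUfg.pow _)
  have hgen : ∀ c ∈ ({x, xs, a, as, y, ys} : Set A), c ∈ U := fun c hc =>
    Submodule.mem_sup_right (Submodule.subset_span hc)
  have h1U : (1 : Submodule K A) ≤ U := le_sup_left
  have hmono : ∀ {c : A} {m : ℕ}, c ∈ U → m ≤ n → c ^ m ∈ U ^ n := fun hc hm =>
    pow_le_pow_right' h1U hm (Submodule.pow_mem_pow _ hc _)
  let f : Fin n × Fin n × Fin n × Fin n → ℕ × ℕ × ℕ × ℕ := fun t => (t.1, t.2.1, t.2.2.1, t.2.2.2)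
  have hf : Function.Injective f := by
    rintro ⟨i, j, k, l⟩ ⟨i', j', k', l'⟩ h
    simp only [f, Prod.mk.injEq, Fin.val_inj] at h
    simp [h]
  have hli' := hli.comp f hf
  have hmem : ∀ t, ((fun t : ℕ × ℕ × ℕ × ℕ =>
      x ^ t.1 * a * (y ^ t.2.1 * ys ^ t.2.2.2) * (as * xs ^ t.2.2.1)) ∘ f) t
        ∈ U ^ (4 * n + 2) := by
    rintro ⟨i, j, k, l⟩
    have e : 4 * n + 2 = (n + 1) + (n + n) + (1 + n) := by ring
    rw [e, pow_add, pow_add, pow_add U n 1, pow_add U 1 n, pow_add U n n, pow_one]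
    simp only [f, Function.comp]
    refine Submodule.mul_mem_mul (Submodule.mul_mem_mul (Submodule.mul_mem_mul ?_ ?_)
      (Submodule.mul_mem_mul ?_ ?_)) (Submodule.mul_mem_mul ?_ ?_)
    · exact hmono (hgen _ (by simp)) i.2.le
    · exact hgen _ (by simp)
    · exact hmono (hgen _ (by simp)) j.2.le
    · exact hmono (hgen _ (by simp)) l.2.le
    · exact hgen _ (by simp)
    · exact hmono (hgen _ (by simp)) k.2.le
  have hli'' : LinearIndependent K (fun t => (⟨_, hmem t⟩ : ↥(U ^ (4 * n + 2)))) :=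
    LinearIndependent.of_comp (U ^ (4 * n + 2)).subtype (by exact hli')
  have := hli''.fintype_card_le_finrank
  simpa [pow_succ, mul_assoc] using this

end Growth

/-! ### The Leavitt path algebra acting on functions on infinite paths -/

section InfinitePaths

variable (V : Type*) [Quiver V]

/-- The infinite paths of the graph, as sequences of composable edges. -/
def InfPath : Type _ := {x : ℕ → Arrow V // ∀ n, (x n).2.1 = (x (n + 1)).1}

variable {V}

/-- Remove the first edge of an infinite path. -/
def InfPath.tail (x : InfPath V) : InfPath V := ⟨fun n => x.1 (n + 1), fun n => x.2 (n + 1)⟩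

/-- Put an edge in front of an infinite path. -/
def InfPath.cons (e : Arrow V) (x : InfPath V) (h : (x.1 0).1 = e.2.1) : InfPath V :=
  ⟨fun n => Nat.casesOn n e x.1, fun n => by cases n with
    | zero => exact h.symm
    | succ n => exact x.2 n⟩

@[simp] theorem InfPath.cons_zero (e : Arrow V) (x : InfPath V) (h : (x.1 0).1 = e.2.1) :
    (InfPath.cons e x h).1 0 = e := rfl

@[simp] theorem InfPath.tail_cons (e : Arrow V) (x : InfPath V) (h : (x.1 0).1 = e.2.1) :
    (InfPath.cons e x h).tail = x := rfl

theorem InfPath.cons_tail (x : InfPath V) (e : Arrow V) (he : x.1 0 = e)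
    (h : (x.tail.1 0).1 = e.2.1) : InfPath.cons e x.tail h = x := by
  apply Subtype.ext
  funext n
  cases n with
  | zero => exact he.symm
  | succ n => rfl

theorem InfPath.exists_start (h : ∀ v : V, ∃ w : V, Nonempty (v ⟶ w)) (v : V) :
    ∃ x : InfPath V, (x.1 0).1 = v := by
  choose w f using h
  let seq : ℕ → V := fun n => w^[n] v
  refine ⟨⟨fun n => ⟨seq n, seq (n + 1), ?_⟩, fun n => rfl⟩, rfl⟩
  have : seq (n + 1) = w (seq n) := Function.iterate_succ_apply' _ _ _
  rw [this]
  exact (f (seq n)).some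

end InfinitePaths

section Representation

variable (K : Type*) [Field K] (V : Type*) [Quiver V]

open Classical in
/-- The action of the generators of the Leavitt path algebra on the functions on infinite paths. -/
noncomputable def genAct : LeavittGen V → Module.End K (InfPath V → K)
  | .vertex v =>
    { toFun := fun φ x => if (x.1 0).1 = v then φ x else 0
      map_add' := fun φ ψ => by funext x; dsimp only [Pi.add_apply]; split_ifs <;> simp
      map_smul' := fun c φ => by funext x; simp }
  | .edge e =>
    { toFun := fun φ x => if x.1 0 = e then φ x.tail else 0
      map_add' := fun φ ψ => by funext x; dsimp only [Pi.add_apply]; split_ifs <;> simp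
      map_smul' := fun c φ => by funext x; simp }
  | .ghost e =>
    { toFun := fun φ x => if h : (x.1 0).1 = e.2.1 then φ (x.cons e h) else 0
      map_add' := fun φ ψ => by funext x; dsimp only [Pi.add_apply]; split_ifs <;> simp
      map_smul' := fun c φ => by funext x; simp }

variable [Fintype V] [∀ v w : V, Fintype (v ⟶ w)]

theorem genAct_rel {a b : FreeAlgebra K (LeavittGen V)} (h : LeavittRel K V a b) :
    FreeAlgebra.lift K (genAct K V) a = FreeAlgebra.lift K (genAct K V) b := by
  classical
  have hstep : ∀ x : InfPath V, (x.tail.1 0).1 = (x.1 0).2.1 := fun x => (x.2 0).symm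
  cases h with
  | vertex_mul_self v =>
    ext φ x
    simp only [genV, map_mul, FreeAlgebra.lift_ι_apply, genAct, Module.End.mul_apply,
      LinearMap.coe_mk, AddHom.coe_mk]
    split_ifs <;> rfl
  | vertex_mul_of_ne v w hvw =>
    ext φ x
    simp only [genV, map_mul, FreeAlgebra.lift_ι_apply, genAct, Module.End.mul_apply,
      LinearMap.coe_mk, AddHom.coe_mk, map_zero, LinearMap.zero_apply, Pi.zero_apply]
    split_ifs with h1 h2
    · exact absurd (h1.symm.trans h2) hvw
    · rfl
    · rfl
  | source_mul e =>
    ext φ x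
    simp only [genV, genE, map_mul, FreeAlgebra.lift_ι_apply, genAct, Module.End.mul_apply,
      LinearMap.coe_mk, AddHom.coe_mk]
    split_ifs with h1 h2 h2
    · rfl
    · rfl
    · exact absurd (by rw [h2]) h1
    · rfl
  | mul_range e =>
    ext φ x
    simp only [genV, genE, map_mul, FreeAlgebra.lift_ι_apply, genAct, Module.End.mul_apply,
      LinearMap.coe_mk, AddHom.coe_mk]
    split_ifs with h1 h2
    · rfl
    · exact absurd ((hstep x).trans (by rw [h1])) h2
    · rfl
  | ghost_mul_source e =>
    ext φ x
    simp [genV, genG, genAct]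
  | range_mul_ghost e =>
    ext φ x
    simp only [genV, genG, map_mul, FreeAlgebra.lift_ι_apply, genAct, Module.End.mul_apply,
      LinearMap.coe_mk, AddHom.coe_mk]
    split_ifs <;> rfl
  | ghost_mul_self e =>
    ext φ x
    simp [genV, genE, genG, genAct]
  | ghost_mul_of_ne e f hef =>
    ext φ x
    simp [genE, genG, genAct, hef]
  | vertex_eq_sum v hv =>
    ext φ x
    have key : ∀ (w : V) (f : v ⟶ w),
        (genAct K V (.edge ⟨v, w, f⟩) (genAct K V (.ghost ⟨v, w, f⟩) φ)) x =
          if x.1 0 = ⟨v, w, f⟩ then φ x else 0 := by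
      intro w f
      simp only [genAct, LinearMap.coe_mk, AddHom.coe_mk]
      split_ifs with h1 h2
      · rw [InfPath.cons_tail _ _ h1]
      · exact absurd ((hstep x).trans (by rw [h1])) h2
      · rfl
    simp only [genV, genE, genG, map_sum, map_mul, FreeAlgebra.lift_ι_apply, LinearMap.sum_apply,
      Finset.sum_apply, Module.End.mul_apply, key]
    simp only [genAct, LinearMap.coe_mk, AddHom.coe_mk]
    split_ifs with h1
    · obtain ⟨w, f, hx⟩ : ∃ (w : V) (f : v ⟶ w), x.1 0 = ⟨v, w, f⟩ := by
        subst h1; exact ⟨_, _, rfl⟩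
      rw [hx, Finset.sum_eq_single_of_mem w (Finset.mem_univ _),
        Finset.sum_eq_single_of_mem f (Finset.mem_univ _)]
      · simp
      · intro g _ hg
        rw [if_neg]
        intro h
        simp only [Sigma.mk.injEq, heq_eq_eq, true_and] at h
        exact hg h.symm
      · intro w' _ hw
        refine Finset.sum_eq_zero fun g _ => if_neg fun h => hw ?_
        simp only [Sigma.mk.injEq, heq_eq_eq, true_and] at h
        exact h.1.symm
    · refine (Finset.sum_eq_zero fun w _ => Finset.sum_eq_zero fun f _ =>
        if_neg fun h => h1 ?_).symm
      rw [h]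
  | sum_vertex =>
    ext φ x
    simp [genV, genAct, LinearMap.sum_apply, Finset.sum_apply]

/-- The representation of the Leavitt path algebra on the functions on infinite paths. -/
noncomputable def infPathRep : LeavittPathAlgebra K V →ₐ[K] Module.End K (InfPath V → K) :=
  RingQuot.liftAlgHom K ⟨FreeAlgebra.lift K (genAct K V), fun _ _ h => genAct_rel K V h⟩

/-- The image of a generator in the Leavitt path algebra. -/
noncomputable def leavittGen (g : LeavittGen V) : LeavittPathAlgebra K V :=
  RingQuot.mkAlgHom K (LeavittRel K V) (FreeAlgebra.ι K g)

variable {V}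

/-- A vertex as an element of the Leavitt path algebra. -/
noncomputable abbrev lvert (v : V) : LeavittPathAlgebra K V := leavittGen K V (.vertex v)

/-- An edge as an element of the Leavitt path algebra. -/
noncomputable abbrev ledge {v w : V} (e : v ⟶ w) : LeavittPathAlgebra K V :=
  leavittGen K V (.edge ⟨v, w, e⟩)

/-- A ghost edge as an element of the Leavitt path algebra. -/
noncomputable abbrev lghostEdge {v w : V} (e : v ⟶ w) : LeavittPathAlgebra K V :=
  leavittGen K V (.ghost ⟨v, w, e⟩)

theorem lvert_mul_self (v : V) : lvert K v * lvert K v = lvert K v := by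
  simpa [leavittGen] using RingQuot.mkAlgHom_rel K (LeavittRel.vertex_mul_self (K := K) v)

theorem lvert_mul_ledge {v w : V} (e : v ⟶ w) : lvert K v * ledge K e = ledge K e := by
  simpa [leavittGen] using RingQuot.mkAlgHom_rel K (LeavittRel.source_mul (K := K) ⟨v, w, e⟩)

theorem ledge_mul_lvert {v w : V} (e : v ⟶ w) : ledge K e * lvert K w = ledge K e := by
  simpa [leavittGen] using RingQuot.mkAlgHom_rel K (LeavittRel.mul_range (K := K) ⟨v, w, e⟩)

theorem lghostEdge_mul_ledge_self {v w : V} (e : v ⟶ w) :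
    lghostEdge K e * ledge K e = lvert K w := by
  simpa [leavittGen] using RingQuot.mkAlgHom_rel K (LeavittRel.ghost_mul_self (K := K) ⟨v, w, e⟩)

theorem lghostEdge_mul_ledge_of_ne {v w v' w' : V} (e : v ⟶ w) (f : v' ⟶ w')
    (h : (⟨v, w, e⟩ : Arrow V) ≠ ⟨v', w', f⟩) : lghostEdge K e * ledge K f = 0 := by
  simpa [leavittGen] using RingQuot.mkAlgHom_rel K (LeavittRel.ghost_mul_of_ne (K := K) _ _ h)

theorem lvert_eq_sum (v : V) (hv : ∃ w : V, Nonempty (v ⟶ w)) :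
    lvert K v = ∑ w : V, ∑ f : v ⟶ w, ledge K f * lghostEdge K f := by
  simpa [leavittGen, map_sum] using RingQuot.mkAlgHom_rel K (LeavittRel.vertex_eq_sum (K := K) v hv)

theorem sum_lvert : ∑ v : V, lvert K v = 1 := by
  simpa [leavittGen, map_sum] using
    RingQuot.mkAlgHom_rel K (LeavittRel.sum_vertex (K := K) (V := V))

/-- Vertices do not vanish in the Leavitt path algebra of a graph without sinks: they act on the
functions on infinite paths as the projections to the paths which start there. -/
theorem lvert_ne_zero (h : ∀ v : V, ∃ w : V, Nonempty (v ⟶ w)) (v : V) : lvert K v ≠ 0 := by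
  intro h0
  obtain ⟨x, hx⟩ := InfPath.exists_start h v
  have h1 := congrArg (infPathRep K V) h0
  have h2 := congrFun (LinearMap.congr_fun h1 (fun _ => 1)) x
  simp [infPathRep, leavittGen, RingQuot.liftAlgHom_mkAlgHom_apply, genAct, hx] at h2

/-- The product of the edges of a path. -/
noncomputable def lpath {v : V} : ∀ {w : V}, Path v w → LeavittPathAlgebra K V
  | _, .nil => lvert K v
  | _, .cons p e => lpath p * ledge K e

/-- The product of the ghost edges of a path, in reverse order. -/
noncomputable def lghost {v : V} : ∀ {w : V}, Path v w → LeavittPathAlgebra K V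
  | _, .nil => lvert K v
  | _, .cons p e => lghostEdge K e * lghost p

theorem lvert_mul_lpath {v w : V} (p : Path v w) : lvert K v * lpath K p = lpath K p := by
  induction p with
  | nil => exact lvert_mul_self K v
  | cons p e ih => rw [lpath, ← mul_assoc, ih]

theorem lghost_mul_lpath {v w : V} (p : Path v w) : lghost K p * lpath K p = lvert K w := by
  induction p with
  | nil => exact lvert_mul_self K v
  | cons p e ih =>
    rw [lghost, lpath, mul_assoc, ← mul_assoc (lghost K p), ih, lvert_mul_ledge,
      lghostEdge_mul_ledge_self]

/-- A closed path with an exit from which another closed path with an exit can be reached makes the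
Gelfand-Kirillov dimension exceed three. -/
theorem three_lt_gkDim_of_paths (h : ∀ v : V, ∃ w : V, Nonempty (v ⟶ w))
    {v x y v' x' y' : V} (e : v ⟶ x) (f : v ⟶ y) (e' : v' ⟶ x') (f' : v' ⟶ y')
    (hef : (⟨v, x, e⟩ : Arrow V) ≠ ⟨v, y, f⟩) (hef' : (⟨v', x', e'⟩ : Arrow V) ≠ ⟨v', y', f'⟩)
    (p : Path x v) (q : Path y v') (p' : Path x' v') :
    3 < gkDim K (LeavittPathAlgebra K V) := by
  have h1 : ∀ {v x w : V} (e : v ⟶ x) (p : Path x w),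
      (lghost K p * lghostEdge K e) * (ledge K e * lpath K p) = lvert K w := by
    intro v x w e p
    rw [mul_assoc, ← mul_assoc (lghostEdge K e), lghostEdge_mul_ledge_self, lvert_mul_lpath,
      lghost_mul_lpath]
  have h2 : ∀ {v x w : V} (e : v ⟶ x) (p : Path x w),
      lvert K v * (ledge K e * lpath K p) = ledge K e * lpath K p := by
    intro v x w e p
    rw [← mul_assoc, lvert_mul_ledge]
  have h3 : ∀ {v x y w w' : V} (e : v ⟶ x) (f : v ⟶ y) (p : Path x w) (q : Path y w')
      (_ : (⟨v, x, e⟩ : Arrow V) ≠ ⟨v, y, f⟩),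
      (lghost K p * lghostEdge K e) * (ledge K f * lpath K q) = 0 := by
    intro v x y w w' e f p q hne
    rw [mul_assoc, ← mul_assoc (lghostEdge K e), lghostEdge_mul_ledge_of_ne K e f hne, zero_mul,
      mul_zero]
  exact three_lt_gkDim_of_toeplitz (h1 e p) (h2 e p) (h2 f q) (h3 e f p q hef)
    (h3 f e q p hef.symm) (h1 f q) (h1 e' p') (h2 e' p') (h2 f' Path.nil)
    (h3 e' f' p' _ hef') (h3 f' e' _ p' hef'.symm) (h1 f' Path.nil) (lvert_ne_zero K h _)

end Representation

/-! ### The graph with one vertex and one edge -/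

section Laurent

/-- An algebra generated by an invertible element has Gelfand-Kirillov dimension less than three. -/
theorem gkDim_lt_three_of_invertible {K A : Type*} [Field K] [Ring A] [Algebra K A] (x y : A)
    (hxy : x * y = 1) (hyx : y * x = 1) (htop : Algebra.adjoin K ({x, y} : Set A) = ⊤) :
    gkDim K A < 3 := by
  let u : Aˣ := ⟨x, y, hxy, hyx⟩
  -- `U d` is the space of Laurent polynomials in `x` of degree at most `d` in absolute value
  let U : ℕ → Submodule K A := fun d =>
    Submodule.span K ((fun i : ℤ => ((u ^ i : Aˣ) : A)) '' (Finset.Icc (-(d : ℤ)) d))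
  have hmem : ∀ (d : ℕ) (i : ℤ), i ∈ Finset.Icc (-(d : ℤ)) d → ((u ^ i : Aˣ) : A) ∈ U d :=
    fun d i hi => Submodule.subset_span ⟨i, hi, rfl⟩
  have hmono : ∀ {d d' : ℕ}, d ≤ d' → U d ≤ U d' := by
    intro d d' h
    refine Submodule.span_mono (Set.image_mono ?_)
    intro i hi
    simp only [Finset.coe_Icc, Set.mem_Icc] at hi ⊢
    omega
  have hmul : ∀ d d', U d * U d' ≤ U (d + d') := by
    intro d d'
    rw [Submodule.span_mul_span]
    refine Submodule.span_le.mpr ?_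
    rintro _ ⟨_, ⟨i, hi, rfl⟩, _, ⟨j, hj, rfl⟩, rfl⟩
    simp only [Finset.coe_Icc, Set.mem_Icc] at hi hj
    simp only [← Units.val_mul, ← zpow_add]
    exact hmem _ _ (by simp only [Finset.mem_Icc]; omega)
  have hone : (1 : Submodule K A) ≤ U 0 := by
    rw [Submodule.one_le]
    simpa using hmem 0 0 (by simp)
  have hpow : ∀ d n, U d ^ n ≤ U (d * n) := by
    intro d n
    induction n with
    | zero => simpa using hone
    | succ n ih =>
      rw [pow_succ]
      exact (mul_le_mul' ih le_rfl).trans (hmul _ _)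
  have hfg : ∀ d, (U d).FG := fun d => Submodule.fg_span ((Finset.finite_toSet _).image _)
  have hrank : ∀ d, Module.finrank K (U d) ≤ 2 * d + 1 := by
    intro d
    classical
    have h : U d = Submodule.span K
      (((Finset.Icc (-(d : ℤ)) d).image (fun i : ℤ => ((u ^ i : Aˣ) : A)) : Finset A) : Set A) := by
      simp only [U, Finset.coe_image]
    rw [h]
    refine (finrank_span_finset_le_card _).trans (Finset.card_image_le.trans ?_)
    simp
    omega
  -- every element lies in some `U d`
  have hexh : ∀ a : A, ∃ d, a ∈ U d := by
    intro a
    have ha : a ∈ Algebra.adjoin K ({x, y} : Set A) := htop ▸ Algebra.mem_top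
    induction ha using Algebra.adjoin_induction with
    | mem b hb =>
      rcases hb with rfl | rfl
      · exact ⟨1, by simpa [u] using hmem 1 1 (by simp)⟩
      · exact ⟨1, by simpa [u] using hmem 1 (-1) (by simp)⟩
    | algebraMap r =>
      refine ⟨0, ?_⟩
      rw [Algebra.algebraMap_eq_smul_one]
      exact Submodule.smul_mem _ _ (Submodule.one_le.mp hone)
    | add a b _ _ ha hb =>
      obtain ⟨d, hd⟩ := ha
      obtain ⟨d', hd'⟩ := hb
      exact ⟨d + d', Submodule.add_mem _ (hmono (by omega) hd) (hmono (by omega) hd')⟩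
    | mul a b _ _ ha hb =>
      obtain ⟨d, hd⟩ := ha
      obtain ⟨d', hd'⟩ := hb
      exact ⟨d + d', hmul _ _ (Submodule.mul_mem_mul hd hd')⟩
  have hW : ∀ W : Submodule K A, W.FG → ∃ d, W ≤ U d := by
    rintro W ⟨s, rfl⟩
    choose g hg using hexh
    refine ⟨s.sup g, Submodule.span_le.mpr fun a ha => hmono (Finset.le_sup ha) (hg a)⟩
  have h2 : ((2 : ℝ) : EReal) < 3 := by
    have : ((2 : ℝ) : EReal) < ((3 : ℝ) : EReal) := by
      rw [EReal.coe_lt_coe_iff]; norm_num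
    exact this
  refine lt_of_le_of_lt (iSup₂_le fun W hWfg => ?_) h2
  obtain ⟨d, hd⟩ := hW W hWfg
  refine Filter.limsup_le_of_le (h := ?_)
  filter_upwards [Filter.eventually_ge_atTop (2 * d + 2)] with n hn
  rw [EReal.coe_le_coe_iff]
  have hle : (1 ⊔ W) ^ n ≤ U (d * n) :=
    (pow_le_pow_left' (sup_le (hone.trans (hmono (Nat.zero_le _))) hd) n).trans (hpow d n)
  have hfin : Module.Finite K (U (d * n)) := Module.Finite.iff_fg.mpr (hfg _)
  have hr : Module.finrank K ↥((1 ⊔ W) ^ n : Submodule K A) ≤ n ^ 2 := by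
    refine (Submodule.finrank_mono hle).trans ((hrank _).trans ?_)
    nlinarith
  rcases Nat.eq_zero_or_pos (Module.finrank K ↥((1 ⊔ W) ^ n : Submodule K A)) with h0 | h0
  · simp [h0]
  · rw [Real.logb_le_iff_le_rpow (by exact_mod_cast (by omega : 1 < n)) (by exact_mod_cast h0)]
    exact_mod_cast hr

/-- A graph which consists of a single loop has Gelfand-Kirillov dimension less than three. -/
theorem gkDim_lt_three_of_loop (K : Type*) [Field K] (V : Type*) [Quiver V] [Fintype V]
    [∀ v w : V, Fintype (v ⟶ w)] (v : V) (hv : ∀ w, w = v) (e : v ⟶ v) (he : ∀ f : v ⟶ v, f = e) :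
    gkDim K (LeavittPathAlgebra K V) < 3 := by
  have h1 : lvert K v = 1 := by
    rw [← sum_lvert K (V := V), Finset.sum_eq_single_of_mem v (Finset.mem_univ _)]
    intro w _ hw
    exact absurd (hv w) hw
  have h2 : ledge K e * lghostEdge K e = 1 := by
    rw [← h1, lvert_eq_sum K v ⟨v, ⟨e⟩⟩, Finset.sum_eq_single_of_mem v (Finset.mem_univ _),
      Finset.sum_eq_single_of_mem e (Finset.mem_univ _)]
    · exact fun f _ hf => absurd (he f) hf
    · exact fun w _ hw => absurd (hv w) hw
  refine gkDim_lt_three_of_invertible (ledge K e) (lghostEdge K e) h2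
    ((lghostEdge_mul_ledge_self K e).trans h1) ?_
  rw [eq_top_iff]
  intro a _
  obtain ⟨a, rfl⟩ := RingQuot.mkAlgHom_surjective K (LeavittRel K V) a
  induction a using FreeAlgebra.induction with
  | grade0 r => rw [AlgHom.commutes]; exact Subalgebra.algebraMap_mem _ r
  | grade1 g =>
    cases g with
    | vertex w =>
      obtain rfl := hv w
      have : RingQuot.mkAlgHom K (LeavittRel K V) (FreeAlgebra.ι K (LeavittGen.vertex w)) = 1 := h1
      rw [this]
      exact one_mem _
    | edge f =>
      obtain ⟨a, b, f⟩ := f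
      obtain rfl := hv a
      obtain rfl := hv b
      obtain rfl := he f
      exact Algebra.subset_adjoin (by left; rfl)
    | ghost f =>
      obtain ⟨a, b, f⟩ := f
      obtain rfl := hv a
      obtain rfl := hv b
      obtain rfl := he f
      exact Algebra.subset_adjoin (by right; rfl)
  | mul a b ha hb => rw [map_mul]; exact Subalgebra.mul_mem _ (ha trivial) (hb trivial)
  | add a b ha hb => rw [map_add]; exact Subalgebra.add_mem _ (ha trivial) (hb trivial)

end Laurent

/-! ### Shift equivalence -/

section ShiftEquivalence

/-- Shift equivalence over `ℕ` with lag `n`. -/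
def ShiftEquiv {ι κ : Type*} [Fintype ι] [Fintype κ] [DecidableEq ι] [DecidableEq κ]
    (A : Matrix ι ι ℕ) (B : Matrix κ κ ℕ) (n : ℕ) : Prop :=
  ∃ (R : Matrix ι κ ℕ) (S : Matrix κ ι ℕ), A * R = R * B ∧ S * A = B * S ∧ A ^ n = R * S ∧
    B ^ n = S * R

theorem mul_pow_comm_of_mul_comm {ι κ : Type*} [Fintype ι] [Fintype κ] [DecidableEq ι]
    [DecidableEq κ] {A : Matrix ι ι ℕ} {B : Matrix κ κ ℕ} {R : Matrix ι κ ℕ}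
    (h : A * R = R * B) (n : ℕ) : A ^ n * R = R * B ^ n := by
  induction n with
  | zero => simp
  | succ n ih => rw [pow_succ, pow_succ', Matrix.mul_assoc, h, ← Matrix.mul_assoc, ih,
      Matrix.mul_assoc, ← pow_succ, pow_succ']

variable {ι κ μ : Type*} [Fintype ι] [Fintype κ] [Fintype μ] [DecidableEq ι] [DecidableEq κ]
  [DecidableEq μ]

theorem ElemEquiv.shiftEquiv {A : Matrix ι ι ℕ} {B : Matrix κ κ ℕ} (h : ElemEquiv A B) :
    ShiftEquiv A B 1 := by
  obtain ⟨R, S, rfl, rfl⟩ := h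
  exact ⟨R, S, by rw [Matrix.mul_assoc], by rw [Matrix.mul_assoc], by rw [pow_one], by rw [pow_one]⟩

theorem ShiftEquiv.trans {A : Matrix ι ι ℕ} {B : Matrix κ κ ℕ} {C : Matrix μ μ ℕ} {m n : ℕ}
    (h : ShiftEquiv A B m) (h' : ShiftEquiv B C n) : ShiftEquiv A C (m + n) := by
  obtain ⟨R, S, h1, h2, h3, h4⟩ := h
  obtain ⟨R', S', h1', h2', h3', h4'⟩ := h'
  refine ⟨R * R', S' * S, ?_, ?_, ?_, ?_⟩
  · rw [← Matrix.mul_assoc, h1, Matrix.mul_assoc, h1', Matrix.mul_assoc]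
  · rw [Matrix.mul_assoc, h2, ← Matrix.mul_assoc, h2', Matrix.mul_assoc]
  · have e : R * R' * (S' * S) = R * (R' * S') * S := by simp only [Matrix.mul_assoc]
    rw [e, ← h3', ← mul_pow_comm_of_mul_comm h1, Matrix.mul_assoc, ← h3, ← pow_add, add_comm]
  · have e : S' * S * (R * R') = S' * (S * R) * R' := by simp only [Matrix.mul_assoc]
    rw [e, ← h4, Matrix.mul_assoc, mul_pow_comm_of_mul_comm h1', ← Matrix.mul_assoc, ← h4',
      ← pow_add, add_comm]

theorem StrongShiftEquiv.exists_shiftEquiv {A : Matrix ι ι ℕ} {B : Matrix κ κ ℕ}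
    (h : StrongShiftEquiv A B) : ∃ n, ShiftEquiv A B n := by
  obtain ⟨X, Y, hX, hXY, hY⟩ := h
  have : ∃ n, ShiftEquiv A Y.2 n := by
    clear hY
    induction hXY with
    | refl => exact ⟨1, hX.shiftEquiv⟩
    | tail _ hbc ih =>
      obtain ⟨n, hn⟩ := ih
      exact ⟨n + 1, hn.trans (ElemEquiv.shiftEquiv hbc)⟩
  obtain ⟨n, hn⟩ := this
  exact ⟨n + 1, hn.trans hY.shiftEquiv⟩

end ShiftEquivalence

section Relabel

variable {ι κ : Type*} [Fintype ι] [Fintype κ]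

theorem elemEquiv_submatrix (A : Matrix ι ι ℕ) (e : κ ≃ ι) :
    ElemEquiv A (A.submatrix e e) := by
  classical
  refine ⟨A.submatrix id e, (1 : Matrix ι ι ℕ).submatrix e id, ?_, ?_⟩
  · rw [Matrix.submatrix_mul_equiv, mul_one, Matrix.submatrix_id_id]
  · rw [← Matrix.submatrix_mul _ _ e id e Function.bijective_id, one_mul]

theorem elemEquiv_submatrix_symm (A : Matrix ι ι ℕ) (e : κ ≃ ι) :
    ElemEquiv (A.submatrix e e) A := by
  obtain ⟨R, S, h1, h2⟩ := elemEquiv_submatrix A e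
  exact ⟨S, R, h2, h1⟩

theorem ElemEquiv.submatrix {A B : Matrix ι ι ℕ} (h : ElemEquiv A B) (e : κ ≃ ι) :
    ElemEquiv (A.submatrix e e) (B.submatrix e e) := by
  obtain ⟨R, S, rfl, rfl⟩ := h
  exact ⟨R.submatrix e e, S.submatrix e e, by rw [Matrix.submatrix_mul_equiv],
    by rw [Matrix.submatrix_mul_equiv]⟩

theorem strongShiftEquiv_of_reflTransGen {A : Matrix ι ι ℕ} {B C : Matrix κ κ ℕ} (e : κ ≃ ι)
    (hA : A.submatrix e e = B) (h : Relation.ReflTransGen ElemEquiv B C) :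
    StrongShiftEquiv A C := by
  let f : Fin (Fintype.card κ) ≃ κ := (Fintype.equivFin κ).symm
  refine ⟨⟨_, A.submatrix (f.trans e) (f.trans e)⟩, ⟨_, C.submatrix f f⟩,
    elemEquiv_submatrix _ _, ?_, elemEquiv_submatrix_symm _ _⟩
  have : A.submatrix (f.trans e) (f.trans e) = B.submatrix f f := by
    rw [← hA]; rfl
  rw [this]
  refine h.lift (fun M => (⟨_, M.submatrix f f⟩ : Σ n : ℕ, Matrix (Fin n) (Fin n) ℕ)) ?_
  intro _ _ hMN
  exact ElemEquiv.submatrix hMN f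

end Relabel

/-! ### Matrices of permutations with trails -/

section Split

variable {V : Type*}

/-- The matrix `T` has nonzero entries only in rows of type `src` and columns of the other type. -/
def Supported (src : V → Prop) (T : Matrix V V ℕ) : Prop :=
  ∀ u v, T u v ≠ 0 → src u ∧ ¬ src v

/-- The sum of the entries of `T` over `L` steps along the orbit of `(u, v)`, both coordinates moved
by `σ`. -/
def orbitSum (σ : Equiv.Perm V) (L : ℕ) (T : Matrix V V ℕ) (u v : V) : ℕ :=
  ∑ n ∈ Finset.range L, T ((σ ^ n) u) ((σ ^ n) v)

/-- The matrix `A` describes a graph in which every vertex `v` has exactly one edge to `σ v`, and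
all other edges lead from a vertex of type `src` to a vertex which is not of that type. -/
structure IsSplit (A : Matrix V V ℕ) (σ : Equiv.Perm V) (src : V → Prop) : Prop where
  src_iff : ∀ v, src (σ v) ↔ src v
  apply_succ : ∀ v, A v (σ v) = 1
  eq_or_of_ne_zero : ∀ v w, A v w ≠ 0 → w = σ v ∨ (src v ∧ ¬ src w)

open Classical in
/-- The part of the matrix which counts the edges from vertices of type `src` to vertices of the
other type. -/
noncomputable def trailMatrix (A : Matrix V V ℕ) (src : V → Prop) : Matrix V V ℕ :=
  Matrix.of fun v w => if src v ∧ ¬ src w then A v w else 0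

theorem supported_trailMatrix (A : Matrix V V ℕ) (src : V → Prop) :
    Supported src (trailMatrix A src) := by
  intro u v h
  by_contra hc
  simp [trailMatrix, hc] at h

/-- The matrix of the permutation `σ`, plus `T`. -/
def permAdd [DecidableEq V] (σ : Equiv.Perm V) (T : Matrix V V ℕ) : Matrix V V ℕ :=
  σ.toPEquiv.toMatrix + T

theorem permAdd_apply [DecidableEq V] (σ : Equiv.Perm V) (T : Matrix V V ℕ) (u v : V) :
    permAdd σ T u v = (if σ u = v then 1 else 0) + T u v := by
  simp [permAdd, PEquiv.toMatrix_apply, eq_comm]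

theorem IsSplit.eq_permAdd [DecidableEq V] {A : Matrix V V ℕ} {σ : Equiv.Perm V} {src : V → Prop}
    (h : IsSplit A σ src) : A = permAdd σ (trailMatrix A src) := by
  ext u v
  rw [permAdd_apply]
  by_cases hv : σ u = v
  · subst hv
    have := h.src_iff u
    rw [h.apply_succ, if_pos rfl, trailMatrix, Matrix.of_apply, if_neg (by tauto)]
  · rw [if_neg hv, zero_add, trailMatrix, Matrix.of_apply]
    split_ifs with hc
    · rfl
    · by_contra h0
      rcases h.eq_or_of_ne_zero u v h0 with h1 | h1
      · exact hv h1.symm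
      · exact hc h1

theorem Supported.mul_eq_zero [Fintype V] {src : V → Prop} {T W : Matrix V V ℕ}
    (hT : Supported src T) (hW : Supported src W) : T * W = 0 := by
  ext u v
  rw [Matrix.mul_apply]
  refine Finset.sum_eq_zero fun w _ => ?_
  by_contra h
  exact (hT u w (left_ne_zero_of_mul h)).2 (hW w v (right_ne_zero_of_mul h)).1

theorem Supported.add {src : V → Prop} {T W : Matrix V V ℕ}
    (hT : Supported src T) (hW : Supported src W) : Supported src (T + W) := by
  intro u v h
  rw [Matrix.add_apply] at h
  rcases Nat.eq_zero_or_pos (T u v) with h0 | h0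
  · exact hW u v (by omega)
  · exact hT u v (by omega)

theorem src_pow {σ : Equiv.Perm V} {src : V → Prop} (hσ : ∀ v, src (σ v) ↔ src v) (n : ℕ) (v : V) :
    src ((σ ^ n) v) ↔ src v := by
  induction n with
  | zero => simp
  | succ n ih => rw [pow_succ', Equiv.Perm.mul_apply, hσ, ih]

theorem orbitSum_trailMatrix_eq_zero {σ : Equiv.Perm V} {src : V → Prop}
    (hσ : ∀ v, src (σ v) ↔ src v) {L : ℕ} {A : Matrix V V ℕ} {u v : V} (h : ¬ (src u ∧ ¬ src v)) :
    orbitSum σ L (trailMatrix A src) u v = 0 := by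
  refine Finset.sum_eq_zero fun k _ => ?_
  rw [trailMatrix, Matrix.of_apply, if_neg]
  rwa [src_pow hσ, src_pow hσ]

theorem supported_single [DecidableEq V] {src : V → Prop} {u v : V} (hu : src u) (hv : ¬ src v) :
    Supported src (Matrix.single u v 1) := by
  intro a b h
  simp only [Matrix.single_apply, ne_eq, ite_eq_right_iff, one_ne_zero, imp_false, not_not] at h
  rwa [← h.1, ← h.2, and_iff_right hu]

theorem orbitSum_add (σ : Equiv.Perm V) (L : ℕ) (T W : Matrix V V ℕ) (u v : V) :
    orbitSum σ L (T + W) u v = orbitSum σ L T u v + orbitSum σ L W u v := by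
  simp [orbitSum, Finset.sum_add_distrib]

theorem orbitSum_single_pow [DecidableEq V] {σ : Equiv.Perm V} {L : ℕ} (hL : σ ^ L = 1) (k : ℕ)
    (u v a b : V) : orbitSum σ L (Matrix.single ((σ ^ k) u) ((σ ^ k) v) 1) a b =
      orbitSum σ L (Matrix.single u v 1) a b := by
  induction k with
  | zero => simp
  | succ k ih =>
    rw [← ih]
    set u' := (σ ^ k) u
    set v' := (σ ^ k) v
    rw [pow_succ', Equiv.Perm.mul_apply, Equiv.Perm.mul_apply]
    have h := Finset.sum_range_succ
      (fun n => Matrix.single (σ u') (σ v') 1 ((σ ^ n) a) ((σ ^ n) b)) L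
    rw [Finset.sum_range_succ', hL, pow_zero] at h
    have h := add_right_cancel h
    rw [orbitSum, ← h, orbitSum]
    refine Finset.sum_congr rfl fun n _ => ?_
    simp [Matrix.single_apply, pow_succ', u', v']

theorem exists_eq_add_single [DecidableEq V] {src : V → Prop} {T : Matrix V V ℕ}
    (hT : Supported src T) {u v : V} (h : T u v ≠ 0) :
    ∃ W, Supported src W ∧ T = W + Matrix.single u v 1 := by
  refine ⟨T - Matrix.single u v 1, fun a b hab => hT a b fun h0 => ?_, ?_⟩
  · simp [h0] at hab
  · ext a b
    by_cases hab : u = a ∧ v = b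
    · obtain ⟨rfl, rfl⟩ := hab
      simp
      omega
    · simp [hab]

variable [Fintype V] [DecidableEq V]

/-- One trail may be moved one step along both cycles: with `Z` the matrix of `σ` and `Y` the matrix
unit at `(σ u, v)`, this is the elementary equivalence of `(Z + W) (1 + Y)` and
`(1 + Y) (Z + W)`. -/
theorem elemEquiv_single_step {σ : Equiv.Perm V} {src : V → Prop} (hσ : ∀ v, src (σ v) ↔ src v)
    {W : Matrix V V ℕ} (hW : Supported src W) {u v : V} (hu : src u) (hv : ¬ src v) :
    ElemEquiv (permAdd σ (W + Matrix.single u v 1))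
      (permAdd σ (W + Matrix.single (σ u) (σ v) 1)) := by
  have hY := supported_single (V := V) ((hσ u).2 hu) hv
  refine ⟨permAdd σ W, 1 + Matrix.single (σ u) v 1, ?_, ?_⟩
  · rw [mul_add, mul_one, permAdd, permAdd, add_mul, hW.mul_eq_zero hY,
      PEquiv.toMatrix_toPEquiv_mul, add_zero, ← add_assoc]
    congr 1
    ext a b
    simp [Matrix.single_apply]
  · rw [add_mul, one_mul, permAdd, permAdd, mul_add, hY.mul_eq_zero hW,
      PEquiv.mul_toMatrix_toPEquiv, add_zero, ← add_assoc]
    congr 1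
    ext a b
    simp [Matrix.single_apply, Equiv.eq_symm_apply]

theorem reflTransGen_single_pow {σ : Equiv.Perm V} {src : V → Prop} (hσ : ∀ v, src (σ v) ↔ src v)
    {W : Matrix V V ℕ} (hW : Supported src W) {u v : V} (hu : src u) (hv : ¬ src v) (k : ℕ) :
    Relation.ReflTransGen ElemEquiv (permAdd σ (W + Matrix.single u v 1))
      (permAdd σ (W + Matrix.single ((σ ^ k) u) ((σ ^ k) v) 1)) := by
  induction k with
  | zero => exact .refl
  | succ k ih =>
    refine ih.tail ?_
    rw [pow_succ', Equiv.Perm.mul_apply, Equiv.Perm.mul_apply]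
    exact elemEquiv_single_step hσ hW ((src_pow hσ k u).2 hu) (mt (src_pow hσ k v).1 hv)

/-- Matrices whose trails have the same orbit sums are joined by a chain of elementary
equivalences. The trails are moved one after the other. -/
theorem reflTransGen_of_orbitSum_eq {σ : Equiv.Perm V} {src : V → Prop}
    (hσ : ∀ v, src (σ v) ↔ src v) {L : ℕ} (hL : σ ^ L = 1) (hL0 : 0 < L) :
    ∀ (N : ℕ) (W T T' : Matrix V V ℕ), Supported src W → Supported src T → Supported src T' →
      (∑ u, ∑ v, T u v = N) → (∀ u v, orbitSum σ L T u v = orbitSum σ L T' u v) →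
      Relation.ReflTransGen ElemEquiv (permAdd σ (W + T)) (permAdd σ (W + T')) := by
  intro N
  induction N with
  | zero =>
    intro W T T' hW hT hT' hN h
    have h0 : T = 0 := by
      ext u v
      simp only [Finset.sum_eq_zero_iff, Finset.mem_univ, true_imp_iff] at hN
      exact hN u v
    have h0' : T' = 0 := by
      ext u v
      have h1 := h u v
      simp only [h0, orbitSum, Matrix.zero_apply, Finset.sum_const_zero] at h1
      simpa using Finset.sum_eq_zero_iff.mp h1.symm 0 (Finset.mem_range.mpr hL0)
    rw [h0, h0']
  | succ N ih =>
    intro W T T' hW hT hT' hN h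
    obtain ⟨u, hu⟩ : ∃ u, ∑ v, T u v ≠ 0 := by
      by_contra! hc
      simp [hc] at hN
    obtain ⟨v, -, huv⟩ := Finset.exists_ne_zero_of_sum_ne_zero hu
    have h1 : orbitSum σ L T u v ≠ 0 := fun h1 =>
      huv (by simpa using Finset.sum_eq_zero_iff.mp h1 0 (Finset.mem_range.mpr hL0))
    rw [h] at h1
    obtain ⟨k, -, hk⟩ := Finset.exists_ne_zero_of_sum_ne_zero h1
    obtain ⟨W₁, hW₁, rfl⟩ := exists_eq_add_single hT huv
    obtain ⟨W₂, hW₂, rfl⟩ := exists_eq_add_single hT' hk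
    have hs := hT u v huv
    have hW' : Supported src (W + Matrix.single u v 1) := hW.add (supported_single hs.1 hs.2)
    have hchain := ih (W + Matrix.single u v 1) W₁ W₂ hW' hW₁ hW₂ (by
      simp only [Matrix.add_apply, Finset.sum_add_distrib] at hN
      have : ∑ x, ∑ y, Matrix.single u v (1 : ℕ) x y = 1 := by
        simp [Matrix.single_apply, ite_and]
      omega) (fun a b => by
        have := h a b
        rw [orbitSum_add, orbitSum_add, orbitSum_single_pow hL] at this
        omega)
    have hmove := reflTransGen_single_pow hσ (hW.add hW₂) hs.1 hs.2 k
    have e1 : W + (W₁ + Matrix.single u v 1) = W + Matrix.single u v 1 + W₁ := by abel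
    have e2 : W + (W₂ + Matrix.single ((σ ^ k) u) ((σ ^ k) v) 1) =
      W + W₂ + Matrix.single ((σ ^ k) u) ((σ ^ k) v) 1 := by abel
    have e3 : W + Matrix.single u v 1 + W₂ = W + W₂ + Matrix.single u v 1 := by abel
    rw [e1, e2]
    rw [e3] at hchain
    exact hchain.trans hmove

/-- A path of length `n` follows the cycles, and uses at most one trail: after `k` steps, for some
`k < n`. -/
theorem permAdd_pow_apply {σ : Equiv.Perm V} {src : V → Prop} (hσ : ∀ v, src (σ v) ↔ src v)
    {T : Matrix V V ℕ} (hT : Supported src T) (n : ℕ) (u v : V) :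
    (permAdd σ T ^ n) u ((σ ^ n) v) = (if u = v then 1 else 0) +
      ∑ k ∈ Finset.range n, T ((σ ^ k) u) ((σ ^ k) (σ v)) := by
  induction n generalizing u v with
  | zero => simp [Matrix.one_apply]
  | succ n ih =>
    rw [pow_succ', permAdd, add_mul, PEquiv.toMatrix_toPEquiv_mul, ← permAdd, Matrix.add_apply,
      Matrix.submatrix_apply, id, pow_succ, Equiv.Perm.mul_apply, ih, Matrix.mul_apply]
    have h1 : ∀ w, T u w * (permAdd σ T ^ n) w ((σ ^ n) (σ v)) =
        if w = σ v then T u (σ v) else 0 := by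
      intro w
      rw [ih]
      by_cases hw : T u w = 0
      · rw [hw, zero_mul]
        split_ifs with h
        · rw [← h, hw]
        · rfl
      · have : ∀ k, T ((σ ^ k) w) ((σ ^ k) (σ (σ v))) = 0 := by
          intro k
          by_contra hc
          exact (hT u w hw).2 ((src_pow hσ k w).1 (hT _ _ hc).1)
        simp only [this, Finset.sum_const_zero, add_zero]
        split_ifs with h
        · rw [h, mul_one]
        · rw [mul_zero]
    rw [Finset.sum_congr rfl fun w _ => h1 w, Finset.sum_ite_eq' Finset.univ,
      if_pos (Finset.mem_univ _), Finset.sum_range_succ' _ n]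
    simp [pow_succ, add_assoc]

theorem permAdd_pow_period_apply {σ : Equiv.Perm V} {src : V → Prop}
    (hσ : ∀ v, src (σ v) ↔ src v) {T : Matrix V V ℕ} (hT : Supported src T) {L : ℕ}
    (hL : σ ^ L = 1) (u v : V) :
    (permAdd σ T ^ L) u v = (if u = v then 1 else 0) + orbitSum σ L T u (σ v) := by
  have := permAdd_pow_apply hσ hT L u v
  rwa [hL, Equiv.Perm.one_apply] at this

end Split

/-! ### Strong shift equivalence and orbit sums -/

section OrbitMatch

variable {V V' : Type*}

/-- The bijection `φ` matches the permutations, the types of the vertices and the orbit sums of the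
trails of two split matrices. The number `L` is a common period of the two permutations. -/
structure OrbitMatch (A : Matrix V V ℕ) (σ : Equiv.Perm V) (src : V → Prop)
    (B : Matrix V' V' ℕ) (σ' : Equiv.Perm V') (src' : V' → Prop) (L : ℕ) (φ : V ≃ V') : Prop where
  period_pos : 0 < L
  pow_left : σ ^ L = 1
  pow_right : σ' ^ L = 1
  map_succ : ∀ v, φ (σ v) = σ' (φ v)
  src_iff : ∀ v, src' (φ v) ↔ src v
  orbitSum_eq : ∀ u v, orbitSum σ L (trailMatrix A src) u v =
    orbitSum σ' L (trailMatrix B src') (φ u) (φ v)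

variable {A : Matrix V V ℕ} {σ : Equiv.Perm V} {src : V → Prop}
    {B : Matrix V' V' ℕ} {σ' : Equiv.Perm V'} {src' : V' → Prop}

theorem map_pow_of_map_succ {φ : V ≃ V'} (h : ∀ v, φ (σ v) = σ' (φ v)) (n : ℕ) (v : V) :
    φ ((σ ^ n) v) = (σ' ^ n) (φ v) := by
  induction n with
  | zero => simp
  | succ n ih => rw [pow_succ', pow_succ', Equiv.Perm.mul_apply, Equiv.Perm.mul_apply, h, ih]

theorem exists_pair_of_mul_apply_eq_one {α β : Type*} [Fintype β] (M : Matrix α β ℕ)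
    (N : Matrix β α ℕ) (u : α) (h : (M * N) u u = 1) :
    ∃ x, (M u x = 1 ∧ N x u = 1) ∧ ∀ y, M u y = 1 → N y u = 1 → y = x := by
  classical
  rw [Matrix.mul_apply] at h
  obtain ⟨x, -, hx⟩ := Finset.exists_ne_zero_of_sum_ne_zero (h.trans_ne one_ne_zero)
  have hle : ∀ y, M u y * N y u ≤ 1 := fun y =>
    (Finset.single_le_sum (f := fun y => M u y * N y u) (fun _ _ => Nat.zero_le _)
      (Finset.mem_univ y)).trans h.le
  have hx1 : M u x * N x u = 1 := le_antisymm (hle x) (Nat.one_le_iff_ne_zero.mpr hx)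
  refine ⟨x, mul_eq_one.mp hx1, fun y h3 h4 => ?_⟩
  by_contra hne
  have := Finset.sum_le_sum_of_subset (f := fun y => M u y * N y u)
    (Finset.subset_univ {x, y})
  rw [Finset.sum_pair (Ne.symm hne), h, hx1, h3, h4] at this
  omega

theorem mul_apply_ne_zero {α β : Type*} [Fintype β] {M : Matrix α β ℕ} {N : Matrix β α ℕ}
    {u v : α} {x : β} (h1 : M u x ≠ 0) (h2 : N x v ≠ 0) : (M * N) u v ≠ 0 := by
  intro h3
  rw [Matrix.mul_apply, Finset.sum_eq_zero_iff] at h3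
  exact mul_ne_zero h1 h2 (h3 x (Finset.mem_univ _))

theorem orbitSum_ne_zero {L : ℕ} (hL0 : 0 < L) (hL : σ ^ L = 1) {T : Matrix V V ℕ} {u v : V} (n : ℕ)
    (h : T ((σ ^ n) u) ((σ ^ n) v) ≠ 0) : orbitSum σ L T u v ≠ 0 := by
  intro h0
  rw [pow_eq_pow_mod n hL] at h
  exact h (Finset.sum_eq_zero_iff.mp h0 (n % L) (Finset.mem_range.mpr (Nat.mod_lt _ hL0)))

variable [Fintype V] [Fintype V']

theorem OrbitMatch.strongShiftEquiv {L : ℕ} {φ : V ≃ V'} (hA : IsSplit A σ src)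
    (hB : IsSplit B σ' src') (h : OrbitMatch A σ src B σ' src' L φ) : StrongShiftEquiv A B := by
  classical
  let T : Matrix V' V' ℕ := (trailMatrix A src).submatrix φ.symm φ.symm
  have hT : Supported src' T := by
    intro u v huv
    have := supported_trailMatrix A src _ _ huv
    rwa [← h.src_iff, ← h.src_iff, φ.apply_symm_apply, φ.apply_symm_apply] at this
  have hAT : A.submatrix φ.symm φ.symm = permAdd σ' (0 + T) := by
    ext u v
    obtain ⟨u, rfl⟩ := φ.surjective u
    obtain ⟨v, rfl⟩ := φ.surjective v
    rw [Matrix.submatrix_apply, hA.eq_permAdd, permAdd_apply, permAdd_apply, ← h.map_succ]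
    simp [T]
  refine strongShiftEquiv_of_reflTransGen φ.symm hAT ?_
  rw [hB.eq_permAdd]
  have := reflTransGen_of_orbitSum_eq hB.src_iff h.pow_right h.period_pos _ 0 T
    (trailMatrix B src') (fun u v h => absurd rfl h) hT (supported_trailMatrix _ _) rfl (by
      intro u v
      obtain ⟨u, rfl⟩ := φ.surjective u
      obtain ⟨v, rfl⟩ := φ.surjective v
      rw [← h.orbitSum_eq]
      simp [orbitSum, T, ← map_pow_of_map_succ h.map_succ])
  rwa [zero_add (trailMatrix B src')] at this

/-- A shift equivalence with large lag determines a bijection of the vertices: the vertex matched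
with `u` is the only `x` with `R u x` and `S x u` both nonzero. -/
theorem exists_equiv_of_diag_eq_one
    {R : Matrix V V' ℕ} {S : Matrix V' V ℕ}
    (h1 : ∀ u, (R * S) u u = 1) (h2 : ∀ x, (S * R) x x = 1) :
    ∃ φ : V ≃ V', (∀ u, R u (φ u) = 1) ∧ (∀ u, S (φ u) u = 1) := by
  choose f hf hf' using fun u => exists_pair_of_mul_apply_eq_one R S u (h1 u)
  choose g hg hg' using fun x => exists_pair_of_mul_apply_eq_one S R x (h2 x)
  refine ⟨⟨f, g, fun u => ?_, fun x => ?_⟩, fun u => (hf u).1, fun u => (hf u).2⟩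
  · exact (hg' _ u (hf u).2 (hf u).1).symm
  · exact (hf' _ x (hg x).2 (hg x).1).symm

/-- Strong shift equivalent split matrices match, provided that every vertex of type `src` has a
trail leaving its orbit and every other vertex has a trail entering its orbit. These trails make the
bijection of the vertices preserve their types. -/
theorem exists_orbitMatch_of_strongShiftEquiv (hA : IsSplit A σ src) (hB : IsSplit B σ' src')
    (hout : ∀ u, src u → ∃ (k : ℕ) (w : V), A ((σ ^ k) u) w ≠ 0 ∧ ¬ src w)
    (hin : ∀ v, ¬ src v → ∃ (k : ℕ) (w : V), A w ((σ ^ k) v) ≠ 0 ∧ src w)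
    (h : StrongShiftEquiv A B) : ∃ L φ, OrbitMatch A σ src B σ' src' L φ := by
  classical
  obtain ⟨n, R, S₀, hAR, hSA, hRS₀, hSR₀⟩ := h.exists_shiftEquiv
  -- a common period which is at least the lag
  obtain ⟨L, m, hL0, hL, hL', hLn⟩ : ∃ L m, 0 < L ∧ σ ^ L = 1 ∧ σ' ^ L = 1 ∧ L = n + m := by
    have p1 := orderOf_pos σ
    have p2 := orderOf_pos σ'
    have p3 : n + 1 ≤ orderOf σ * orderOf σ' * (n + 1) := Nat.le_mul_of_pos_left _ (by positivity)
    refine ⟨orderOf σ * orderOf σ' * (n + 1), orderOf σ * orderOf σ' * (n + 1) - n, by positivity,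
      ?_, ?_, by omega⟩
    · rw [mul_assoc, pow_mul, pow_orderOf_eq_one, one_pow]
    · rw [mul_comm (orderOf σ), mul_assoc, pow_mul, pow_orderOf_eq_one, one_pow]
  obtain ⟨S, hRS, hSR⟩ : ∃ S : Matrix V' V ℕ, R * S = A ^ L ∧ S * R = B ^ L := by
    refine ⟨S₀ * A ^ m, ?_, ?_⟩
    · rw [← Matrix.mul_assoc, ← hRS₀, ← pow_add, hLn]
    · rw [Matrix.mul_assoc, mul_pow_comm_of_mul_comm hAR, ← Matrix.mul_assoc, ← hSR₀,
        ← pow_add, hLn]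
  set T := trailMatrix A src with hTdef
  set T' := trailMatrix B src' with hTdef'
  have hT : Supported src T := supported_trailMatrix A src
  have hT' : Supported src' T' := supported_trailMatrix B src'
  set X : V → V → ℕ := fun u v => orbitSum σ L T u (σ v) with hX
  set X' : V' → V' → ℕ := fun u v => orbitSum σ' L T' u (σ' v) with hX'
  have hXs : ∀ u v, X u v ≠ 0 → src u ∧ ¬ src v := by
    intro u v h
    obtain ⟨k, -, hk⟩ := Finset.exists_ne_zero_of_sum_ne_zero h
    have := hT _ _ hk
    rwa [src_pow hA.src_iff, src_pow hA.src_iff, hA.src_iff] at this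
  have hXs' : ∀ u v, X' u v ≠ 0 → src' u ∧ ¬ src' v := by
    intro u v h
    obtain ⟨k, -, hk⟩ := Finset.exists_ne_zero_of_sum_ne_zero h
    have := hT' _ _ hk
    rwa [src_pow hB.src_iff, src_pow hB.src_iff, hB.src_iff] at this
  have hP : ∀ u v, (R * S) u v = (if u = v then 1 else 0) + X u v := by
    intro u v
    rw [hRS, hA.eq_permAdd, permAdd_pow_period_apply hA.src_iff hT hL]
  have hP' : ∀ u v, (S * R) u v = (if u = v then 1 else 0) + X' u v := by
    intro u v
    rw [hSR, hB.eq_permAdd, permAdd_pow_period_apply hB.src_iff hT' hL']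
  have hXd : ∀ u, X u u = 0 := fun u => by
    by_contra hc; exact (hXs u u hc).2 (hXs u u hc).1
  have hXd' : ∀ u, X' u u = 0 := fun u => by
    by_contra hc; exact (hXs' u u hc).2 (hXs' u u hc).1
  obtain ⟨φ, hRφ, hSφ⟩ := exists_equiv_of_diag_eq_one (R := R) (S := S)
    (fun u => by rw [hP, hXd, if_pos rfl]) (fun u => by rw [hP', hXd', if_pos rfl])
  -- nonzero entries of `R` and `S` off the bijection come from trails of both graphs
  have hR1 : ∀ u w, R u (φ w) ≠ 0 → u = w ∨ X u w ≠ 0 := by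
    intro u w h1
    have := mul_apply_ne_zero h1 ((hSφ w).trans_ne one_ne_zero)
    rw [hP] at this
    by_cases huw : u = w
    · exact .inl huw
    · right; simpa [huw] using this
  have hR2 : ∀ u w, R u (φ w) ≠ 0 → u = w ∨ X' (φ u) (φ w) ≠ 0 := by
    intro u w h1
    have := mul_apply_ne_zero ((hSφ u).trans_ne one_ne_zero) h1
    rw [hP'] at this
    by_cases huw : u = w
    · exact .inl huw
    · right; simpa [huw] using this
  have hS1 : ∀ u w, S (φ w) u ≠ 0 → w = u ∨ X w u ≠ 0 := by
    intro u w h1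
    have := mul_apply_ne_zero ((hRφ w).trans_ne one_ne_zero) h1
    rw [hP] at this
    by_cases huw : w = u
    · exact .inl huw
    · right; simpa [huw] using this
  have hS2 : ∀ u w, S (φ w) u ≠ 0 → w = u ∨ X' (φ w) (φ u) ≠ 0 := by
    intro u w h1
    have := mul_apply_ne_zero h1 ((hRφ u).trans_ne one_ne_zero)
    rw [hP'] at this
    by_cases huw : w = u
    · exact .inl huw
    · right; simpa [huw] using this
  -- a trail of the first graph gives one of the second, so types are preserved
  have hXX : ∀ u v, X u v ≠ 0 → X' (φ u) (φ v) ≠ 0 := by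
    intro u v h1
    have huv : u ≠ v := by rintro rfl; exact h1 (hXd u)
    have h2 : (R * S) u v ≠ 0 := by rw [hP]; simpa [huv] using h1
    rw [Matrix.mul_apply] at h2
    obtain ⟨x, -, hx⟩ := Finset.exists_ne_zero_of_sum_ne_zero h2
    obtain ⟨w, rfl⟩ := φ.surjective x
    have hx1 := left_ne_zero_of_mul hx
    have hx2 := right_ne_zero_of_mul hx
    rcases hR1 u w hx1 with rfl | h3
    · exact (hS2 v u hx2).resolve_left huv
    · rcases hS1 v w hx2 with rfl | h4
      · exact (hR2 u w hx1).resolve_left huv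
      · exact absurd (hXs _ _ h4).1 (hXs _ _ h3).2
  have hsrc : ∀ v, src' (φ v) ↔ src v := by
    have h1 : ∀ v, src v → src' (φ v) := by
      intro u hu
      obtain ⟨k, w, hkw, hw⟩ := hout u hu
      suffices h : X u (σ.symm ((σ ^ k).symm w)) ≠ 0 from (hXs' _ _ (hXX _ _ h)).1
      refine orbitSum_ne_zero hL0 hL k ?_
      simpa [T, trailMatrix, src_pow hA.src_iff, hu, hw] using hkw
    have h2 : ∀ v, ¬ src v → ¬ src' (φ v) := by
      intro v hv
      obtain ⟨k, w, hkw, hw⟩ := hin v hv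
      suffices h : X ((σ ^ (k + L - 1)).symm w) v ≠ 0 from (hXs' _ _ (hXX _ _ h)).2
      refine orbitSum_ne_zero hL0 hL (k + L - 1) ?_
      rw [← Equiv.Perm.mul_apply _ σ, ← pow_succ, show k + L - 1 + 1 = k + L by omega, pow_add, hL,
        mul_one, Equiv.apply_symm_apply]
      simpa [T, trailMatrix, src_pow hA.src_iff, hv, hw] using hkw
    exact fun v => ⟨fun h => by_contra fun hc => h2 v hc h, h1 v⟩
  -- compare the entries at `(u, φ v)` of `A ^ L * R = R * B ^ L`
  have hXeq : ∀ u v, X u v = X' (φ u) (φ v) := by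
    intro u v
    have h1 : ((R * S) * R) u (φ v) = (R * (S * R)) u (φ v) := by rw [Matrix.mul_assoc]
    rw [Matrix.mul_apply, Matrix.mul_apply] at h1
    simp only [hP, hP', add_mul, mul_add, Finset.sum_add_distrib] at h1
    rw [Finset.sum_eq_single_of_mem u (Finset.mem_univ _),
      Finset.sum_eq_single_of_mem v (Finset.mem_univ _),
      Finset.sum_eq_single_of_mem (φ v) (Finset.mem_univ _),
      Finset.sum_eq_single_of_mem (φ u) (Finset.mem_univ _)] at h1
    · simp only [if_true, hRφ, one_mul, mul_one] at h1
      exact add_left_cancel h1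
    · intro x _ hx
      obtain ⟨w, rfl⟩ := φ.surjective x
      by_contra hc
      rcases hR2 u w (left_ne_zero_of_mul hc) with rfl | h2
      · exact hx rfl
      · exact (hXs' _ _ h2).2 (hXs' _ _ (right_ne_zero_of_mul hc)).1
    · intro x _ hx
      rw [if_neg hx, mul_zero]
    · intro w _ hw
      by_contra hc
      rcases hR1 w v (right_ne_zero_of_mul hc) with rfl | h2
      · exact hw rfl
      · exact (hXs _ _ (left_ne_zero_of_mul hc)).2 (hXs _ _ h2).1
    · intro w _ hw
      rw [if_neg (Ne.symm hw), zero_mul]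
  -- compare the entries at `(u, φ (σ u))` of `A * R = R * B`
  have hφσ : ∀ u, φ (σ u) = σ' (φ u) := by
    intro u
    have h1 : (A * R) u (φ (σ u)) ≠ 0 := by
      rw [Matrix.mul_apply]
      intro h0
      have := Finset.sum_eq_zero_iff.mp h0 (σ u) (Finset.mem_univ _)
      rw [hA.apply_succ, hRφ] at this
      omega
    rw [hAR, Matrix.mul_apply] at h1
    obtain ⟨x, -, hx⟩ := Finset.exists_ne_zero_of_sum_ne_zero h1
    obtain ⟨w, rfl⟩ := φ.surjective x
    have hs : src' (φ (σ u)) ↔ src u := (hsrc _).trans (hA.src_iff u)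
    rcases hR1 u w (left_ne_zero_of_mul hx) with rfl | h2
    · rcases hB.eq_or_of_ne_zero _ _ (right_ne_zero_of_mul hx) with h3 | h3
      · exact h3
      · exact absurd (hs.2 ((hsrc u).1 h3.1)) h3.2
    · have h4 := hXs _ _ h2
      have h5 : ¬ src' (φ w) := mt (hsrc w).1 h4.2
      rcases hB.eq_or_of_ne_zero _ _ (right_ne_zero_of_mul hx) with h3 | h3
      · have := hs.2 h4.1
        rw [h3, hB.src_iff] at this
        exact absurd this h5
      · exact absurd h3.1 h5
  refine ⟨L, φ, hL0, hL, hL', hφσ, hsrc, fun u v => ?_⟩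
  have := hXeq u (σ.symm v)
  simp only [hX, hX', ← hφσ, Equiv.apply_symm_apply] at this
  exact this

end OrbitMatch

/-! ### Reachability and strongly connected components -/

section Reachability

variable {V : Type*} [Quiver V]

/-- There is a path from `v` to `w`. -/
def Reach (v w : V) : Prop := Nonempty (Path v w)

theorem Reach.refl (v : V) : Reach v v := ⟨Path.nil⟩

theorem Reach.trans {u v w : V} (h : Reach u v) (h' : Reach v w) : Reach u w :=
  ⟨h.some.comp h'.some⟩

theorem Reach.of_edge {v w : V} (e : v ⟶ w) : Reach v w := ⟨e.toPath⟩

theorem Reach.eq_or_exists_edge {v w : V} (h : Reach v w) :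
    v = w ∨ ∃ (x : V) (_ : v ⟶ x), Reach x w := by
  obtain ⟨p⟩ := h
  induction p with
  | nil => exact .inl rfl
  | cons p e ih =>
    rcases ih with rfl | ⟨x, e', h'⟩
    · exact .inr ⟨_, e, .refl _⟩
    · exact .inr ⟨x, e', h'.trans (.of_edge e)⟩

/-- Every vertex from which `v` can be reached can be reached from `v`. -/
def Initial (v : V) : Prop := ∀ u, Reach u v → Reach v u

/-- From every vertex which can be reached from `v` one can return to `v`. -/
def Terminal (v : V) : Prop := ∀ u, Reach v u → Reach u v

theorem Initial.of_reach {u v : V} (hv : Initial v) (h : Reach u v) : Initial u :=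
  fun _ hx => h.trans (hv _ (hx.trans h))

theorem Terminal.of_reach {u v : V} (hv : Terminal v) (h : Reach v u) : Terminal u :=
  fun _ hx => (hv _ (h.trans hx)).trans h

/-- The vertex `v` lies on a closed path of positive length. -/
def Recurrent (v : V) : Prop := ∃ (w : V) (_ : v ⟶ w), Reach w v

theorem Recurrent.of_reach {u v : V} (hv : Recurrent v) (h : Reach v u) (h' : Reach u v) :
    Recurrent u := by
  rcases h'.eq_or_exists_edge with rfl | ⟨x, e, hx⟩
  · exact hv
  · exact ⟨x, e, hx.trans h⟩

theorem Terminal.recurrent (hess : IsEssential V) {v : V} (hv : Terminal v) : Recurrent v := by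
  obtain ⟨w, ⟨e⟩⟩ := hess.1 v
  exact ⟨w, e, hv w (.of_edge e)⟩

theorem Initial.recurrent (hess : IsEssential V) {v : V} (hv : Initial v) : Recurrent v := by
  obtain ⟨x, ⟨e⟩⟩ := hess.2 v
  rcases (hv x (.of_edge e)).eq_or_exists_edge with rfl | ⟨y, e', hy⟩
  · exact ⟨_, e, .refl _⟩
  · exact ⟨y, e', hy.trans (.of_edge e)⟩

theorem exists_initial_reach [Finite V] (v : V) : ∃ u, Initial u ∧ Reach u v := by
  induction h : Set.ncard {u | Reach u v} using Nat.strong_induction_on generalizing v with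
  | _ n ih =>
    by_cases hv : Initial v
    · exact ⟨v, hv, .refl v⟩
    · simp only [Initial, not_forall] at hv
      obtain ⟨u, hu, hvu⟩ := hv
      obtain ⟨x, hx, hxu⟩ := ih _ (h ▸ Set.ncard_lt_ncard (s := {x | Reach x u})
        ⟨fun x hx => Reach.trans hx hu, fun hs => hvu (hs (Reach.refl v))⟩ (Set.toFinite _)) u rfl
      exact ⟨x, hx, hxu.trans hu⟩

theorem exists_terminal_reach [Finite V] (v : V) : ∃ u, Terminal u ∧ Reach v u := by
  induction h : Set.ncard {u | Reach v u} using Nat.strong_induction_on generalizing v with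
  | _ n ih =>
    by_cases hv : Terminal v
    · exact ⟨v, hv, .refl v⟩
    · simp only [Terminal, not_forall] at hv
      obtain ⟨u, hu, hvu⟩ := hv
      obtain ⟨x, hx, hxu⟩ := ih _ (h ▸ Set.ncard_lt_ncard (s := {x | Reach u x})
        ⟨fun x hx => Reach.trans hu hx, fun hs => hvu (hs (Reach.refl v))⟩ (Set.toFinite _)) u rfl
      exact ⟨x, hx, hu.trans hxu⟩

/-- A crossing edge of a path from a vertex with the property `P` to a vertex without it. -/
theorem Reach.exists_edge_of_not {P : V → Prop} {v w : V} (h : Reach v w) (hv : P v) (hw : ¬ P w) :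
    ∃ (a b : V) (_ : a ⟶ b), Reach v a ∧ Reach b w ∧ P a ∧ ¬ P b := by
  obtain ⟨p⟩ := h
  induction p with
  | nil => exact absurd hv hw
  | @cons x w p e ih =>
    by_cases hx : P x
    · exact ⟨x, w, e, ⟨p⟩, .refl _, hx, hw⟩
    · obtain ⟨a, b, f, h1, h2, h3⟩ := ih hx
      exact ⟨a, b, f, h1, h2.trans (.of_edge e), h3⟩

/-- In a weakly connected graph, a nonempty set of vertices which no edge leaves or enters contains
all vertices. -/
theorem forall_of_isWeaklyConnected (h : IsWeaklyConnected V) {P : V → Prop}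
    (hP : ∀ (a b : V) (_ : a ⟶ b), P a ↔ P b) {v : V} (hv : P v) (w : V) : P w := by
  have := h.2
  have h1 : (v : WeaklyConnectedComponent V) = (w : WeaklyConnectedComponent V) :=
    Subsingleton.elim _ _
  obtain ⟨p⟩ := (WeaklyConnectedComponent.eq v w).mp h1
  clear h1
  have key : ∀ {a b : Symmetrify V} (p : Path a b), P a → P b := by
    intro a b p ha
    induction p with
    | nil => exact ha
    | cons p e ih =>
      rcases e with e | e
      · exact (hP _ _ e).1 ih
      · exact (hP _ _ e).2 ih
  exact key p hv

end Reachability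

/-! ### Cycles from periodic orbits -/

section CycleOfPeriodic

variable {V : Type*} [Quiver V]

/-- The cycle formed by a periodic orbit of `f`, where every vertex of the orbit has an edge to its
image under `f`. -/
noncomputable def cycleOfPeriodic (f : V → V) (v : V) (hv : v ∈ Function.periodicPts f)
    (he : ∀ n, Nonempty (f^[n] v ⟶ f (f^[n] v))) : IndexedCycle V where
  length := Function.minimalPeriod f v
  length_pos := Function.minimalPeriod_pos_of_mem_periodicPts hv
  vertex k := f^[k.val] v
  vertex_injective := by
    have : NeZero (Function.minimalPeriod f v) :=
      ⟨(Function.minimalPeriod_pos_of_mem_periodicPts hv).ne'⟩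
    intro k l h
    exact ZMod.val_injective _
      (Function.iterate_injOn_Iio_minimalPeriod (ZMod.val_lt k) (ZMod.val_lt l) h)
  edge k := Nonempty.some (by
    have : NeZero (Function.minimalPeriod f v) :=
      ⟨(Function.minimalPeriod_pos_of_mem_periodicPts hv).ne'⟩
    have h : f^[(k + 1).val] v = f (f^[k.val] v) := by
      rw [ZMod.val_add, ZMod.val_one_eq_one_mod, Nat.add_mod_mod,
        Function.iterate_mod_minimalPeriod_eq, Function.iterate_succ_apply']
    rw [h]
    exact he _)

theorem cycleOfPeriodic_vertex_natCast (f : V → V) (v : V) (hv : v ∈ Function.periodicPts f)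
    (he : ∀ n, Nonempty (f^[n] v ⟶ f (f^[n] v))) (n : ℕ) :
    (cycleOfPeriodic f v hv he).vertex n = f^[n] v := by
  change f^[((n : ZMod (Function.minimalPeriod f v))).val] v = _
  rw [ZMod.val_natCast, Function.iterate_mod_minimalPeriod_eq]

theorem IndexedCycle.reach_vertex (c : IndexedCycle V) (k l : ZMod c.length) :
    Reach (c.vertex k) (c.vertex l) := by
  have : NeZero c.length := ⟨c.length_pos.ne'⟩
  have h : ∀ n : ℕ, Reach (c.vertex k) (c.vertex (k + n)) := by
    intro n
    induction n with
    | zero => simpa using Reach.refl _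
    | succ n ih =>
      rw [Nat.cast_succ, ← add_assoc]
      exact ih.trans (.of_edge (c.edge _))
  simpa using h (l - k).val

theorem OnSourceCycle.initial {v : V} (h : OnSourceCycle v) : Initial v := by
  obtain ⟨c, hc, k, rfl⟩ := h
  intro u ⟨p⟩
  have key : ∀ {w : V} (p : Path u w), (w ∈ Set.range c.vertex) → u ∈ Set.range c.vertex := by
    intro w p
    induction p with
    | nil => exact id
    | cons p e ih =>
      rintro ⟨l, rfl⟩
      obtain ⟨m, hm⟩ := hc l _ e
      exact ih ⟨m, congrArg (fun a => a.1) hm⟩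
  obtain ⟨l, rfl⟩ := key p ⟨k, rfl⟩
  exact c.reach_vertex _ _

theorem OnSinkCycle.terminal {v : V} (h : OnSinkCycle v) : Terminal v := by
  obtain ⟨c, hc, k, rfl⟩ := h
  intro u ⟨p⟩
  have key : u ∈ Set.range c.vertex := by
    induction p with
    | nil => exact ⟨k, rfl⟩
    | cons p e ih =>
      obtain ⟨l, rfl⟩ := ih
      obtain ⟨m, hm⟩ := hc l _ e
      exact ⟨m + 1, congrArg (fun a => a.2.1) hm⟩
  obtain ⟨l, rfl⟩ := key
  exact c.reach_vertex _ _

end CycleOfPeriodic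

/-! ### Source and sink cycles in normal form -/

section Structure

variable {V : Type*} [Quiver V]

variable (V) in
/-- At most one edge with a given source lies on a closed path. Equivalently, different cycles have
no vertex in common. -/
def UniqueReturn : Prop :=
  ∀ a b : Arrow V, a.1 = b.1 → Reach a.2.1 a.1 → Reach b.2.1 b.1 → a = b

theorem UniqueReturn.arrow_eq (h : UniqueReturn V) {a b : Arrow V} (hab : a.1 = b.1)
    (ha : Reach a.2.1 a.1) (hb : Reach b.2.1 b.1) : a = b :=
  h a b hab ha hb

open Classical in
/-- The range of an edge which starts at the given recurrent vertex and lies on a closed path. -/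
noncomputable def nextVertex (v : V) : V := if h : Recurrent v then h.choose else v

theorem Recurrent.exists_edge {v : V} (h : Recurrent v) :
    ∃ _ : v ⟶ nextVertex v, Reach (nextVertex v) v := by
  rw [nextVertex, dif_pos h]
  exact h.choose_spec

theorem Recurrent.reach_iterate {v : V} (h : Recurrent v) (n : ℕ) :
    Reach v (nextVertex^[n] v) ∧ Reach (nextVertex^[n] v) v := by
  induction n with
  | zero => exact ⟨.refl _, .refl _⟩
  | succ n ih =>
    obtain ⟨e, he⟩ := (h.of_reach ih.1 ih.2).exists_edge
    rw [Function.iterate_succ_apply']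
    exact ⟨ih.1.trans (.of_edge e), he.trans ih.2⟩

theorem UniqueReturn.eq_nextVertex (h : UniqueReturn V) {v w : V} (e : v ⟶ w)
    (he : Reach w v) : w = nextVertex v := by
  obtain ⟨f, hf⟩ := Recurrent.exists_edge ⟨w, e, he⟩
  have := h.arrow_eq (a := ⟨v, w, e⟩) (b := ⟨v, _, f⟩) rfl he hf
  exact congrArg (fun a => a.2.1) this

theorem UniqueReturn.exists_iterate (h : UniqueReturn V) {v w : V} (hvw : Reach v w)
    (hwv : Reach w v) : ∃ n, nextVertex^[n] v = w := by
  obtain ⟨p⟩ := hvw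
  induction p with
  | nil => exact ⟨0, rfl⟩
  | cons p e ih =>
    obtain ⟨n, rfl⟩ := ih ((Reach.of_edge e).trans hwv)
    refine ⟨n + 1, ?_⟩
    rw [Function.iterate_succ_apply']
    exact (h.eq_nextVertex e (hwv.trans ⟨p⟩)).symm

theorem UniqueReturn.exists_cycle (h : UniqueReturn V) {v : V} (hv : Recurrent v) :
    ∃ c : IndexedCycle V, v ∈ Set.range c.vertex := by
  obtain ⟨e, he⟩ := hv.exists_edge
  obtain ⟨n, hn⟩ := h.exists_iterate he (.of_edge e)
  have hper : v ∈ Function.periodicPts nextVertex :=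
    Function.mk_mem_periodicPts (Nat.succ_pos n) (by
      rw [Function.IsPeriodicPt, Function.IsFixedPt, Function.iterate_succ_apply, hn])
  refine ⟨cycleOfPeriodic nextVertex v hper fun m => ?_, ((0 : ℕ) : ZMod _), ?_⟩
  · have hm := hv.reach_iterate m
    obtain ⟨e', -⟩ := (hv.of_reach hm.1 hm.2).exists_edge
    exact ⟨e'⟩
  · rw [cycleOfPeriodic_vertex_natCast]
    rfl

theorem UniqueReturn.vertex_add_one (h : UniqueReturn V) (c : IndexedCycle V)
    (k : ZMod c.length) : c.vertex (k + 1) = nextVertex (c.vertex k) :=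
  h.eq_nextVertex (c.edge k) (c.reach_vertex _ _)

theorem UniqueReturn.mem_range_vertex (h : UniqueReturn V) (c : IndexedCycle V)
    (k : ZMod c.length) {w : V} (hw : Reach (c.vertex k) w) (hw' : Reach w (c.vertex k)) :
    w ∈ Set.range c.vertex := by
  obtain ⟨n, rfl⟩ := h.exists_iterate hw hw'
  clear hw hw'
  induction n generalizing k with
  | zero => exact ⟨k, rfl⟩
  | succ n ih =>
    rw [Function.iterate_succ_apply, ← h.vertex_add_one]
    exact ih (k + 1)

theorem UniqueReturn.onSourceCycle_iff (hess : IsEssential V) (h : UniqueReturn V) (v : V) :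
    OnSourceCycle v ↔ Initial v := by
  refine ⟨OnSourceCycle.initial, fun hv => ?_⟩
  obtain ⟨c, k, rfl⟩ := h.exists_cycle (hv.recurrent hess)
  refine ⟨c, fun l x g => ?_, k, rfl⟩
  have hx : Reach x (c.vertex k) := (Reach.of_edge g).trans (c.reach_vertex _ _)
  obtain ⟨m, rfl⟩ := h.mem_range_vertex c k (hv _ hx) hx
  exact ⟨m, h.arrow_eq rfl (c.reach_vertex _ _) (c.reach_vertex _ _)⟩

theorem UniqueReturn.onSinkCycle_iff (hess : IsEssential V) (h : UniqueReturn V) (v : V) :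
    OnSinkCycle v ↔ Terminal v := by
  refine ⟨OnSinkCycle.terminal, fun hv => ?_⟩
  obtain ⟨c, k, rfl⟩ := h.exists_cycle (hv.recurrent hess)
  refine ⟨c, fun l x g => ?_, k, rfl⟩
  have hx : Reach (c.vertex k) x := (c.reach_vertex _ _).trans (Reach.of_edge g)
  exact ⟨l, h.arrow_eq rfl (c.reach_vertex _ _) ((hv _ hx).trans (c.reach_vertex _ _))⟩

theorem path_comp_eq_comp {u v w x : V} (p : Path u v) (p' : Path v w) (q : Path u x)
    (r : Path x w) (h : p.comp p' = q.comp r) :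
    (∃ r' : Path x v, p = q.comp r') ∨ ∃ q' : Path v x, p' = q'.comp r := by
  induction p' with
  | nil => exact .inl ⟨r, h⟩
  | @cons y z p' e ih =>
    cases r with
    | nil => exact .inr ⟨p'.cons e, rfl⟩
    | cons r f =>
      rw [Path.comp_cons, Path.comp_cons] at h
      obtain rfl := Path.obj_eq_of_cons_eq_cons h
      obtain rfl := eq_of_heq (Path.hom_heq_of_cons_eq_cons h)
      rcases ih r (eq_of_heq (Path.heq_of_cons_eq_cons h)) with h1 | ⟨q', rfl⟩
      · exact .inl h1
      · exact .inr ⟨q', rfl⟩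

/-- A shortest path which leads from a vertex of an initial strongly connected component to `v`. -/
theorem exists_shortest_from_initial [Finite V] {v : V} (h1 : ¬ Initial v) (h2 : ¬ Terminal v) :
    ∃ (y : V) (p : Path y v), Initial y ∧ 0 < p.length ∧ ∀ (u : V) (q : Path y u) (r : Path u v),
      p = q.comp r → 0 < q.length → ¬ Initial u ∧ ¬ Terminal u := by
  classical
  have hex : ∃ n, ∃ (y : V) (p : Path y v), Initial y ∧ p.length = n := by
    obtain ⟨y, hy, ⟨p⟩⟩ := exists_initial_reach v
    exact ⟨_, y, p, hy, rfl⟩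
  obtain ⟨y, p, hy, hp⟩ := Nat.find_spec hex
  refine ⟨y, p, hy, ?_, fun u q r hqr hq => ⟨fun hu => ?_, fun hu => h2 (hu.of_reach ⟨r⟩)⟩⟩
  · rcases Nat.eq_zero_or_pos p.length with h0 | h0
    · exact absurd (Path.eq_of_length_zero p h0 ▸ hy) h1
    · exact h0
  · refine Nat.find_min hex (m := r.length) ?_ ⟨u, r, hu, rfl⟩
    rw [← hp, hqr, Path.length_comp]
    omega

theorem exists_shortest_to_terminal [Finite V] {v : V} (h1 : ¬ Initial v) (h2 : ¬ Terminal v) :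
    ∃ (z : V) (p : Path v z), Terminal z ∧ 0 < p.length ∧ ∀ (u : V) (q : Path v u) (r : Path u z),
      p = q.comp r → 0 < r.length → ¬ Initial u ∧ ¬ Terminal u := by
  classical
  have hex : ∃ n, ∃ (z : V) (p : Path v z), Terminal z ∧ p.length = n := by
    obtain ⟨y, hy, ⟨p⟩⟩ := exists_terminal_reach v
    exact ⟨_, y, p, hy, rfl⟩
  obtain ⟨z, p, hz, hp⟩ := Nat.find_spec hex
  refine ⟨z, p, hz, ?_, fun u q r hqr hr => ⟨fun hu => h1 (hu.of_reach ⟨q⟩), fun hu => ?_⟩⟩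
  · rcases Nat.eq_zero_or_pos p.length with h0 | h0
    · exact absurd (Path.eq_of_length_zero p h0 ▸ hz) h2
    · exact h0
  · refine Nat.find_min hex (m := q.length) ?_ ⟨u, q, hu, rfl⟩
    rw [← hp, hqr, Path.length_comp]
    omega

theorem isTrail_toPath {v w : V} (e : v ⟶ w) (hv : OnSourceCycle v) (hw : OnSinkCycle w) :
    IsTrail e.toPath := by
  refine ⟨by simp, hv, hw, fun u q r hqr hq hr => ?_⟩
  have := congrArg Path.length hqr
  rw [Path.length_comp] at this
  simp at this
  omega

/-- In normal form every vertex lies on a source cycle or on a sink cycle, since a trail through any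
other vertex would have length at least two. -/
theorem UniqueReturn.initial_or_terminal_of_isNormalForm [Finite V] (hess : IsEssential V)
    (h : UniqueReturn V) (hn : IsNormalForm V) (v : V) : Initial v ∨ Terminal v := by
  by_contra! hc
  obtain ⟨h1, h2⟩ := hc
  obtain ⟨y, p, hy, hp, hpu⟩ := exists_shortest_from_initial h1 h2
  obtain ⟨z, p', hz, hp', hpu'⟩ := exists_shortest_to_terminal h1 h2
  have := hn.1 y z (p.comp p') ⟨by rw [Path.length_comp]; omega, (h.onSourceCycle_iff hess y).2 hy,
    (h.onSinkCycle_iff hess z).2 hz, fun u q r hqr hq hr => by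
      rw [h.onSourceCycle_iff hess, h.onSinkCycle_iff hess]
      rcases path_comp_eq_comp p p' q r hqr with ⟨r', h3⟩ | ⟨q', h3⟩
      · exact hpu u q r' h3 hq
      · exact hpu' u q' r h3 hr⟩
  rw [Path.length_comp] at this
  omega

/-- If some vertex is on both a source and a sink cycle, this cycle is the whole graph; as all its
edges are trails, it has only one vertex. -/
theorem UniqueReturn.exists_loop (hess : IsEssential V) (hconn : IsWeaklyConnected V)
    (h : UniqueReturn V) (hn : IsNormalForm V) {v : V} (h1 : Initial v) (h2 : Terminal v) :
    (∀ w, w = v) ∧ ∃ e : v ⟶ v, ∀ f : v ⟶ v, f = e := by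
  have hall : ∀ w, Reach v w ∧ Reach w v := by
    refine forall_of_isWeaklyConnected hconn (P := fun w => Reach v w ∧ Reach w v) ?_
      ⟨Reach.refl v, Reach.refl v⟩
    intro a b e
    refine ⟨fun ha => ?_, fun hb => ?_⟩
    · have := ha.1.trans (.of_edge e)
      exact ⟨this, h2 _ this⟩
    · have := (Reach.of_edge e).trans hb.2
      exact ⟨h1 _ this, this⟩
  have hsrc : ∀ w, OnSourceCycle w := fun w =>
    (h.onSourceCycle_iff hess w).2 (h1.of_reach (hall w).2)
  have hsnk : ∀ w, OnSinkCycle w := fun w =>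
    (h.onSinkCycle_iff hess w).2 (h2.of_reach (hall w).1)
  obtain ⟨c, hc, k, rfl⟩ := hsrc v
  have heq : ∀ w, w = c.vertex k := by
    intro w
    obtain ⟨l, rfl⟩ := h.mem_range_vertex c k (hall w).1 (hall w).2
    obtain ⟨x, ⟨e⟩⟩ := hess.1 (c.vertex l)
    obtain ⟨y, ⟨f⟩⟩ := hess.1 (c.vertex k)
    exact hn.2 c hc l k x y e.toPath f.toPath (isTrail_toPath e (hsrc _) (hsnk _))
      (isTrail_toPath f (hsrc _) (hsnk _))
  obtain ⟨w, ⟨e⟩⟩ := hess.1 (c.vertex k)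
  obtain rfl := (heq w).symm
  refine ⟨heq, e, fun f => ?_⟩
  have := h.arrow_eq (a := ⟨c.vertex k, c.vertex k, f⟩) (b := ⟨_, _, e⟩) rfl (.refl _) (.refl _)
  simpa using this

end Structure

/-! ### The permutation of the vertices -/

section Cyclic

variable (V : Type*) [Quiver V] [∀ v w : V, Fintype (v ⟶ w)]

/-- The shape of a graph of Gelfand-Kirillov dimension three in normal form: the permutation `succ`
moves every vertex one step along its cycle, and the remaining edges lead from source cycles to sink
cycles, with only one vertex of each source cycle emitting such edges. -/
structure CyclicStructure where
  succ : Equiv.Perm V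
  isSplit : IsSplit (adjMatrix V) succ OnSourceCycle
  onSinkCycle_iff : ∀ v : V, OnSinkCycle v ↔ ¬ OnSourceCycle v
  vertex_add_one : ∀ (c : IndexedCycle V) (k : ZMod c.length), c.vertex (k + 1) = succ (c.vertex k)
  exists_trail_from : ∀ u : V, OnSourceCycle u →
    ∃ (k : ℕ) (w : V), adjMatrix V ((succ ^ k) u) w ≠ 0 ∧ ¬ OnSourceCycle w
  exists_trail_to : ∀ v : V, ¬ OnSourceCycle v →
    ∃ (k : ℕ) (w : V), adjMatrix V w ((succ ^ k) v) ≠ 0 ∧ OnSourceCycle w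
  source_unique : ∀ (c : IndexedCycle V), c.IsSourceCycle → ∀ (k l : ZMod c.length) (w w' : V),
    ¬ OnSourceCycle w → ¬ OnSourceCycle w' → adjMatrix V (c.vertex k) w ≠ 0 →
    adjMatrix V (c.vertex l) w' ≠ 0 → k = l

variable {V}

theorem adjMatrix_ne_zero_iff {v w : V} : adjMatrix V v w ≠ 0 ↔ Nonempty (v ⟶ w) := by
  simp [adjMatrix, Fintype.card_eq_zero_iff, not_isEmpty_iff]

theorem UniqueReturn.nonempty_cyclicStructure [Finite V] (hess : IsEssential V)
    (hconn : IsWeaklyConnected V) (h : UniqueReturn V) (hn : IsNormalForm V)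
    (hloop : ∀ v : V, ¬ ((∀ w, w = v) ∧ ∃ e : v ⟶ v, ∀ f : v ⟶ v, f = e)) :
    Nonempty (CyclicStructure V) := by
  have hit := h.initial_or_terminal_of_isNormalForm hess hn
  have hnot : ∀ v : V, Initial v → ¬ Terminal v := fun v h1 h2 =>
    hloop v (h.exists_loop hess hconn hn h1 h2)
  have hrec : ∀ v : V, Recurrent v := fun v =>
    (hit v).elim (fun h1 => h1.recurrent hess) (fun h1 => h1.recurrent hess)
  have hS := h.onSourceCycle_iff hess
  have hT := h.onSinkCycle_iff hess
  have hsurj : Function.Surjective (nextVertex : V → V) := by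
    intro v
    obtain ⟨e, he⟩ := (hrec v).exists_edge
    obtain ⟨n, hn⟩ := h.exists_iterate he (.of_edge e)
    rw [← Function.iterate_succ_apply, Function.iterate_succ_apply'] at hn
    exact ⟨_, hn⟩
  let σ : Equiv.Perm V := Equiv.ofBijective nextVertex
    ⟨Finite.injective_iff_surjective.mpr hsurj, hsurj⟩
  have hσ : ∀ v, σ v = nextVertex v := fun v => rfl
  have hσn : ∀ (n : ℕ) (v : V), (σ ^ n) v = nextVertex^[n] v := by
    intro n v
    rw [← Equiv.Perm.iterate_eq_pow]
    rfl
  refine ⟨⟨σ, ⟨?_, ?_, ?_⟩, ?_, h.vertex_add_one, ?_, ?_, ?_⟩⟩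
  · intro v
    obtain ⟨e, he⟩ := (hrec v).exists_edge
    rw [hS, hS, hσ]
    exact ⟨fun h1 => h1.of_reach (.of_edge e), fun h1 => h1.of_reach he⟩
  · intro v
    obtain ⟨e, he⟩ := (hrec v).exists_edge
    rw [hσ, adjMatrix, Matrix.of_apply, Fintype.card_eq_one_iff]
    refine ⟨e, fun f => ?_⟩
    simpa using h.arrow_eq (a := ⟨v, _, f⟩) (b := ⟨v, _, e⟩) rfl he he
  · intro v w hvw
    obtain ⟨e⟩ := adjMatrix_ne_zero_iff.mp hvw
    by_cases hwv : Reach w v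
    · exact .inl (h.eq_nextVertex e hwv)
    · refine .inr ⟨?_, fun hw => hwv ((hS w).1 hw v (.of_edge e))⟩
      rw [hS]
      exact (hit v).resolve_right fun h1 => hwv (h1 w (.of_edge e))
  · intro v
    rw [hT, hS]
    exact ⟨fun h1 h2 => hnot v h2 h1, fun h1 => (hit v).resolve_left h1⟩
  · intro u hu
    obtain ⟨z, hz, huz⟩ := exists_terminal_reach u
    obtain ⟨a, b, e, h1, -, h2, h3⟩ := huz.exists_edge_of_not (P := OnSourceCycle) hu
      fun hc => hnot z ((hS z).1 hc) hz
    obtain ⟨n, rfl⟩ := h.exists_iterate h1 ((hS a).1 h2 u h1)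
    exact ⟨n, b, by rw [hσn]; exact adjMatrix_ne_zero_iff.mpr ⟨e⟩, h3⟩
  · intro v hv
    obtain ⟨y, hy, hyv⟩ := exists_initial_reach v
    obtain ⟨a, b, e, -, h1, h2, h3⟩ := hyv.exists_edge_of_not (P := OnSourceCycle)
      ((hS y).2 hy) hv
    obtain ⟨n, rfl⟩ := h.exists_iterate (((hit b).resolve_left (mt (hS b).2 h3)) v h1) h1
    exact ⟨n, a, by rw [hσn]; exact adjMatrix_ne_zero_iff.mpr ⟨e⟩, h2⟩
  · intro c hc k l w w' hw hw' hkw hlw'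
    obtain ⟨e⟩ := adjMatrix_ne_zero_iff.mp hkw
    obtain ⟨f⟩ := adjMatrix_ne_zero_iff.mp hlw'
    have hsnk : ∀ w : V, ¬ OnSourceCycle w → OnSinkCycle w := fun w hw =>
      (hT w).2 ((hit w).resolve_left (mt (hS w).2 hw))
    exact c.vertex_injective (hn.2 c hc k l w w' e.toPath f.toPath
      (isTrail_toPath e ⟨c, hc, k, rfl⟩ (hsnk w hw))
      (isTrail_toPath f ⟨c, hc, l, rfl⟩ (hsnk w' hw')))

end Cyclic

section DimensionThree

variable (K : Type*) [Field K] (V : Type*) [Quiver V] [Fintype V] [∀ v w : V, Fintype (v ⟶ w)]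

theorem IsGKDimThree.nonempty_cyclicStructure (h : IsGKDimThree K V) (hn : IsNormalForm V) :
    Nonempty (CyclicStructure V) := by
  obtain ⟨hconn, hess, hdim⟩ := h
  refine UniqueReturn.nonempty_cyclicStructure hess hconn ?_ hn ?_
  · rintro ⟨v, x, e⟩ ⟨v', y, f⟩ hv ⟨p⟩ ⟨q⟩
    obtain rfl : v = v' := hv
    by_contra hne
    have := three_lt_gkDim_of_paths K hess.1 e f e f hne hne p q p
    exact this.ne' hdim
  · rintro v ⟨hv, e, he⟩
    exact (gkDim_lt_three_of_loop K V v hv e he).ne hdim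

end DimensionThree

/-! ### Solutions of two congruences -/

section Counting

theorem sum_range_add_of_periodic {L : ℕ} {f : ℕ → ℕ} (hf : ∀ n, f (n + L) = f n) (y : ℕ) :
    ∑ n ∈ Finset.range L, f (n + y) = ∑ n ∈ Finset.range L, f n := by
  induction y with
  | zero => rfl
  | succ y ih =>
    rw [← ih]
    have h := Finset.sum_range_succ (fun n => f (n + y)) L
    rw [Finset.sum_range_succ', add_comm L y, hf, zero_add] at h
    rw [← add_right_cancel h]
    exact Finset.sum_congr rfl fun n _ => by rw [add_right_comm, add_assoc]

/-- The number of common multiples of `p` and `q` below `L`. -/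
def commonMultiples (p q L : ℕ) : ℕ :=
  ∑ n ∈ Finset.range L, if p ∣ n ∧ q ∣ n then 1 else 0

theorem commonMultiples_pos {p q L : ℕ} (hL : 0 < L) : 0 < commonMultiples p q L :=
  Finset.sum_pos' (fun _ _ => Nat.zero_le _) ⟨0, Finset.mem_range.mpr hL, by simp⟩

/-- The Chinese remainder theorem for moduli which need not be coprime, as a count of the solutions
over a common period of the moduli. -/
theorem sum_ite_modEq_and_modEq {p q L : ℕ} (hp : p ∣ L) (hq : q ∣ L) (hL : 0 < L) (α β : ℤ) :
    (∑ n ∈ Finset.range L, if (n : ℤ) ≡ α [ZMOD p] ∧ (n : ℤ) ≡ β [ZMOD q] then 1 else 0) =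
      if β ≡ α [ZMOD (Nat.gcd p q : ℕ)] then commonMultiples p q L else 0 := by
  have hgp : ((Nat.gcd p q : ℕ) : ℤ) ∣ p := by exact_mod_cast Nat.gcd_dvd_left p q
  have hgq : ((Nat.gcd p q : ℕ) : ℤ) ∣ q := by exact_mod_cast Nat.gcd_dvd_right p q
  split_ifs with h
  · obtain ⟨t, ht⟩ := h.dvd
    rw [Nat.gcd_eq_gcd_ab] at ht
    obtain ⟨x, hx1, hx2⟩ : ∃ x : ℤ, (p : ℤ) ∣ x - α ∧ (q : ℤ) ∣ x - β :=
      ⟨α - p * (Nat.gcdA p q * t), ⟨-(Nat.gcdA p q * t), by ring⟩, ⟨Nat.gcdB p q * t, by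
        linear_combination ht⟩⟩
    -- shifting by a natural number `y ≡ -x` turns the congruences into divisibilities
    obtain ⟨y, hy⟩ : ∃ y : ℕ, (L : ℤ) ∣ y + x := by
      refine ⟨((-x) % L).toNat, ?_⟩
      rw [Int.toNat_of_nonneg (Int.emod_nonneg _ (by exact_mod_cast hL.ne'))]
      have := Int.emod_add_mul_ediv (-x) L
      exact ⟨-((-x) / L), by linarith⟩
    have hpL : (p : ℤ) ∣ L := by exact_mod_cast hp
    have hqL : (q : ℤ) ∣ L := by exact_mod_cast hq
    rw [commonMultiples, ← sum_range_add_of_periodic (L := L)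
      (f := fun n => if p ∣ n ∧ q ∣ n then 1 else 0)
      (fun n => by simp only [Nat.dvd_add_left hp, Nat.dvd_add_left hq]) y]
    have key : ∀ {r : ℕ} {γ : ℤ} (n : ℕ), (r : ℤ) ∣ L → (r : ℤ) ∣ x - γ →
        ((n : ℤ) ≡ γ [ZMOD r] ↔ r ∣ n + y) := by
      intro r γ n hrL hx
      rw [Int.modEq_iff_dvd, ← Int.natCast_dvd_natCast]
      refine Int.dvd_iff_dvd_of_dvd_add ?_
      have := dvd_sub (hrL.trans hy) hx
      have e : γ - n + ((n + y : ℕ) : ℤ) = y + x - (x - γ) := by push_cast; ring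
      rw [e]
      exact this
    exact Finset.sum_congr rfl fun n _ =>
      if_congr (and_congr (key n hpL hx1) (key n hqL hx2)) rfl rfl
  · refine Finset.sum_eq_zero fun n _ => if_neg fun hn => h ?_
    exact (hn.2.of_dvd hgq).symm.trans (hn.1.of_dvd hgp)

end Counting

/-! ### Cycles as orbits of the permutation -/

section Cycles

variable {V : Type*} [Quiver V]

theorem IndexedCycle.SameCycle.range_vertex_eq {c d : IndexedCycle V} (h : c.SameCycle d) :
    Set.range c.vertex = Set.range d.vertex := by
  have key : ∀ c : IndexedCycle V,
      Set.range c.vertex = (fun a : Arrow V => a.1) '' Set.range c.arrow := fun c => by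
    rw [← Set.range_comp]; rfl
  rw [key, key]
  exact congrArg _ h

variable [∀ v w : V, Fintype (v ⟶ w)]

namespace CyclicStructure

theorem arrow_eq (S : CyclicStructure V) {a b : Arrow V} (hab : a.1 = b.1) (ha : a.2.1 = S.succ a.1)
    (hb : b.2.1 = S.succ b.1) : a = b := by
  obtain ⟨v, x, e⟩ := a
  obtain ⟨v', y, f⟩ := b
  obtain rfl : v = v' := hab
  obtain rfl : x = S.succ v := ha
  obtain rfl : y = S.succ v := hb
  have := S.isSplit.apply_succ v
  rw [adjMatrix, Matrix.of_apply, Fintype.card_eq_one_iff] at this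
  obtain ⟨g, hg⟩ := this
  rw [hg e, hg f]

theorem vertex_add_natCast (S : CyclicStructure V) (c : IndexedCycle V) (k : ZMod c.length)
    (n : ℕ) :
    c.vertex (k + n) = (S.succ ^ n) (c.vertex k) := by
  induction n with
  | zero => simp
  | succ n ih => rw [Nat.cast_succ, ← add_assoc, S.vertex_add_one, ih, pow_succ',
      Equiv.Perm.mul_apply]

theorem exists_vertex_eq_pow (S : CyclicStructure V) (c : IndexedCycle V) (k l : ZMod c.length) :
    ∃ n : ℕ, c.vertex l = (S.succ ^ n) (c.vertex k) := by
  have : NeZero c.length := ⟨c.length_pos.ne'⟩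
  refine ⟨(l - k).val, ?_⟩
  rw [← S.vertex_add_natCast]
  simp

theorem sameCycle_of_vertex_eq (S : CyclicStructure V) {c d : IndexedCycle V}
    {k : ZMod c.length} {l : ZMod d.length}
    (h : c.vertex k = d.vertex l) : c.SameCycle d := by
  have key : ∀ {c d : IndexedCycle V} {k : ZMod c.length} {l : ZMod d.length},
      c.vertex k = d.vertex l → Set.range c.arrow ⊆ Set.range d.arrow := by
    rintro c d k l h _ ⟨m, rfl⟩
    obtain ⟨n, hn⟩ := S.exists_vertex_eq_pow c k m
    rw [h, ← S.vertex_add_natCast] at hn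
    exact ⟨l + n, S.arrow_eq hn.symm (S.vertex_add_one _ _) (S.vertex_add_one _ _)⟩
  exact (key h).antisymm (key h.symm)

theorem sameCycle_iff (S : CyclicStructure V) {c d : IndexedCycle V} :
    c.SameCycle d ↔ Set.range c.vertex = Set.range d.vertex := by
  refine ⟨fun h => h.range_vertex_eq, fun h => ?_⟩
  obtain ⟨l, hl⟩ : c.vertex 0 ∈ Set.range d.vertex := h ▸ ⟨0, rfl⟩
  exact S.sameCycle_of_vertex_eq hl.symm

theorem onSourceCycle_vertex_iff (S : CyclicStructure V) (c : IndexedCycle V)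
    (k l : ZMod c.length) :
    OnSourceCycle (c.vertex l) ↔ OnSourceCycle (c.vertex k) := by
  obtain ⟨n, hn⟩ := S.exists_vertex_eq_pow c k l
  rw [hn, src_pow S.isSplit.src_iff]

theorem isSourceCycle_iff (S : CyclicStructure V) (c : IndexedCycle V) (k : ZMod c.length) :
    c.IsSourceCycle ↔ OnSourceCycle (c.vertex k) := by
  refine ⟨fun h => ⟨c, h, k, rfl⟩, fun h l x g => ?_⟩
  rw [← S.onSourceCycle_vertex_iff c k l] at h
  have hl := (S.isSplit.eq_or_of_ne_zero _ _ (adjMatrix_ne_zero_iff.mpr ⟨g⟩)).resolve_right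
    fun h1 => h1.2 h
  have h2 : c.vertex l = S.succ (c.vertex (l - 1)) := by
    rw [← S.vertex_add_one, sub_add_cancel]
  exact ⟨l - 1, S.arrow_eq (S.succ.injective (h2.symm.trans hl)) (S.vertex_add_one _ _) hl⟩

theorem isSinkCycle_iff (S : CyclicStructure V) (c : IndexedCycle V) (k : ZMod c.length) :
    c.IsSinkCycle ↔ ¬ OnSourceCycle (c.vertex k) := by
  refine ⟨fun h => (S.onSinkCycle_iff _).1 ⟨c, h, k, rfl⟩, fun h l x g => ?_⟩
  rw [← S.onSourceCycle_vertex_iff c k l] at h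
  have hl := (S.isSplit.eq_or_of_ne_zero _ _ (adjMatrix_ne_zero_iff.mpr ⟨g⟩)).resolve_right
    fun h1 => h h1.1
  exact ⟨l, S.arrow_eq rfl (S.vertex_add_one _ _) hl⟩

/-- A finite list of representatives of the cycles with a given property. -/
theorem exists_enumeration (S : CyclicStructure V) [Finite V] (P : IndexedCycle V → Prop) :
    ∃ (m : ℕ) (C : Fin m → IndexedCycle V), (∀ i, P (C i)) ∧
      ∀ c, P c → ∃! i, c.SameCycle (C i) := by
  let X : Set (Set V) := {s | ∃ c, P c ∧ Set.range c.vertex = s}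
  obtain ⟨m, ⟨e⟩⟩ := Finite.exists_equiv_fin X
  choose C hC hCe using fun i => (e.symm i).2
  refine ⟨m, C, hC, fun c hc => ⟨e ⟨_, c, hc, rfl⟩, ?_, fun i hi => ?_⟩⟩
  · simp only [S.sameCycle_iff, hCe, Equiv.symm_apply_apply]
  · simp only [S.sameCycle_iff, hCe] at hi
    rw [← Equiv.symm_apply_eq]
    exact Subtype.ext hi.symm

theorem exists_pointing (S : CyclicStructure V) [Finite V] : ∃ m n, Nonempty (Pointing V m n) := by
  obtain ⟨m, C, hC, hC'⟩ := S.exists_enumeration fun c => c.IsSourceCycle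
  obtain ⟨n, D, hD, hD'⟩ := S.exists_enumeration fun c => c.IsSinkCycle
  exact ⟨m, n, ⟨⟨C, D, hC, hD, hC', hD'⟩⟩⟩

end CyclicStructure

/-- The source and sink cycles of a pointing, as one family. -/
def Pointing.cycle {m n : ℕ} (P : Pointing V m n) : Fin m ⊕ Fin n → IndexedCycle V :=
  Sum.elim P.C P.D

namespace CyclicStructure

theorem existsUnique_cycle (S : CyclicStructure V) {m n : ℕ} (P : Pointing V m n) (v : V) :
    ∃! x, v ∈ Set.range (P.cycle x).vertex := by
  have hC : ∀ i k, OnSourceCycle ((P.C i).vertex k) := fun i k =>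
    (S.isSourceCycle_iff _ k).1 (P.source_C i)
  have hD : ∀ j k, ¬ OnSourceCycle ((P.D j).vertex k) := fun j k =>
    (S.isSinkCycle_iff _ k).1 (P.sink_D j)
  by_cases hv : OnSourceCycle v
  · obtain ⟨c, hc, k, rfl⟩ := hv
    obtain ⟨i, hi, hi'⟩ := P.existsUnique_C c hc
    refine ⟨.inl i, ?_, ?_⟩
    · change c.vertex k ∈ Set.range (P.C i).vertex
      exact hi.range_vertex_eq ▸ ⟨k, rfl⟩
    · rintro (i' | j) ⟨l, hl⟩
      · exact congrArg _ (hi' _ (S.sameCycle_of_vertex_eq hl.symm))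
      · exact absurd ((S.isSourceCycle_iff _ _).1 hc) (hl ▸ hD j l)
  · obtain ⟨c, hc, k, rfl⟩ := (S.onSinkCycle_iff v).2 hv
    obtain ⟨j, hj, hj'⟩ := P.existsUnique_D c hc
    refine ⟨.inr j, ?_, ?_⟩
    · change c.vertex k ∈ Set.range (P.D j).vertex
      exact hj.range_vertex_eq ▸ ⟨k, rfl⟩
    · rintro (i | j') ⟨l, hl⟩
      · exact absurd (hl ▸ hC i l) hv
      · exact congrArg _ (hj' _ (S.sameCycle_of_vertex_eq hl.symm))

end CyclicStructure

end Cycles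

/-! ### Transport of cycles and pointings -/

section Transport

variable {V V' : Type*} [Quiver V] [Quiver V']

theorem exists_map_of_partition {I : Type*} (c : I → IndexedCycle V) (d : I → IndexedCycle V')
    (hlen : ∀ i, (c i).length = (d i).length)
    (hc : ∀ v, ∃! i, v ∈ Set.range (c i).vertex) (t : I → ℤ) :
    ∃ f : V → V', ∀ (i : I) (z : ℤ), f ((c i).vertex z) = (d i).vertex ((z + t i : ℤ)) := by
  have h : ∀ v, ∃ (i : I) (z : ℤ), (c i).vertex z = v := by
    intro v
    obtain ⟨i, ⟨k, hk⟩, -⟩ := hc v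
    obtain ⟨z, rfl⟩ := ZMod.intCast_surjective k
    exact ⟨i, z, hk⟩
  choose g y hy using h
  refine ⟨fun v => (d (g v)).vertex ((y v + t (g v) : ℤ)), fun i z => ?_⟩
  have h1 := hy ((c i).vertex z)
  beta_reduce
  generalize g ((c i).vertex z) = i' at h1 ⊢
  generalize y ((c i).vertex z) = y' at h1 ⊢
  obtain rfl : i' = i := (hc ((c i).vertex z)).unique ⟨_, h1⟩ ⟨_, rfl⟩
  have h2 := (c i').vertex_injective h1
  rw [ZMod.intCast_eq_intCast_iff, hlen] at h2
  refine congrArg _ ?_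
  rw [ZMod.intCast_eq_intCast_iff]
  exact h2.add_right _

/-- Two graphs partitioned into cycles of the same lengths have a bijection between their vertices
which maps each cycle to the corresponding one, with prescribed shifts of the indices. -/
theorem exists_equiv_of_partition {I : Type*} (c : I → IndexedCycle V) (d : I → IndexedCycle V')
    (hlen : ∀ i, (c i).length = (d i).length)
    (hc : ∀ v, ∃! i, v ∈ Set.range (c i).vertex) (hd : ∀ v, ∃! i, v ∈ Set.range (d i).vertex)
    (t : I → ℤ) :
    ∃ φ : V ≃ V', ∀ (i : I) (z : ℤ), φ ((c i).vertex z) = (d i).vertex ((z + t i : ℤ)) := by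
  obtain ⟨f, hf⟩ := exists_map_of_partition c d hlen hc t
  obtain ⟨g, hg⟩ := exists_map_of_partition d c (fun i => (hlen i).symm) hd (fun i => - t i)
  refine ⟨⟨f, g, fun v => ?_, fun v => ?_⟩, hf⟩
  · obtain ⟨i, ⟨k, rfl⟩, -⟩ := hc v
    obtain ⟨z, rfl⟩ := ZMod.intCast_surjective k
    rw [hf, hg, add_neg_cancel_right]
  · obtain ⟨i, ⟨k, rfl⟩, -⟩ := hd v
    obtain ⟨z, rfl⟩ := ZMod.intCast_surjective k
    rw [hg, hf, neg_add_cancel_right]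

variable [∀ v w : V, Fintype (v ⟶ w)] [∀ v w : V', Fintype (v ⟶ w)] (S : CyclicStructure V)
  (S' : CyclicStructure V') (φ : V ≃ V') (hφ : ∀ v, φ (S.succ v) = S'.succ (φ v))

/-- The image of a cycle under a bijection of the vertices which commutes with the step along the
cycles. -/
noncomputable def mapCycle (c : IndexedCycle V) : IndexedCycle V' where
  length := c.length
  length_pos := c.length_pos
  vertex := φ ∘ c.vertex
  vertex_injective := φ.injective.comp c.vertex_injective
  edge k := Nonempty.some (by
    rw [Function.comp_apply, Function.comp_apply, S.vertex_add_one, hφ, ← adjMatrix_ne_zero_iff,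
      S'.isSplit.apply_succ]
    exact one_ne_zero)

/-- The image of a pointing under a bijection of the vertices which commutes with the step along the
cycles and preserves the type of the cycles. -/
noncomputable def Pointing.map (hsrc : ∀ v, OnSourceCycle (φ v) ↔ OnSourceCycle v) {m n : ℕ}
    (P : Pointing V m n) : Pointing V' m n :=
  have hφ' : ∀ v, φ.symm (S'.succ v) = S.succ (φ.symm v) := fun v => by
    rw [Equiv.symm_apply_eq, hφ, Equiv.apply_symm_apply]
  have hsame : ∀ (c : IndexedCycle V') (d : IndexedCycle V),
      c.SameCycle (mapCycle S S' φ hφ d) ↔ (mapCycle S' S φ.symm hφ' c).SameCycle d := by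
    intro c d
    rw [S.sameCycle_iff, S'.sameCycle_iff]
    change Set.range c.vertex = Set.range (φ ∘ d.vertex) ↔
      Set.range (φ.symm ∘ c.vertex) = Set.range d.vertex
    rw [Set.range_comp, Set.range_comp, Equiv.eq_image_iff_symm_image_eq]
  have hS : ∀ c : IndexedCycle V, (mapCycle S S' φ hφ c).IsSourceCycle ↔ c.IsSourceCycle :=
    fun c => by
      rw [S'.isSourceCycle_iff _ (0 : ZMod c.length), S.isSourceCycle_iff _ (0 : ZMod c.length)]
      exact hsrc _
  have hT : ∀ c : IndexedCycle V, (mapCycle S S' φ hφ c).IsSinkCycle ↔ c.IsSinkCycle :=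
    fun c => by
      rw [S'.isSinkCycle_iff _ (0 : ZMod c.length), S.isSinkCycle_iff _ (0 : ZMod c.length)]
      exact not_congr (hsrc _)
  have hS' : ∀ c : IndexedCycle V', c.IsSourceCycle → (mapCycle S' S φ.symm hφ' c).IsSourceCycle :=
    fun c hc => by
      rw [S.isSourceCycle_iff _ (0 : ZMod c.length), ← hsrc]
      exact (φ.apply_symm_apply _).symm ▸ (S'.isSourceCycle_iff _ _).1 hc
  have hT' : ∀ c : IndexedCycle V', c.IsSinkCycle → (mapCycle S' S φ.symm hφ' c).IsSinkCycle :=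
    fun c hc => by
      rw [S.isSinkCycle_iff _ (0 : ZMod c.length), ← hsrc]
      exact (φ.apply_symm_apply _).symm ▸ (S'.isSinkCycle_iff _ _).1 hc
  { C := fun i => mapCycle S S' φ hφ (P.C i)
    D := fun j => mapCycle S S' φ hφ (P.D j)
    source_C := fun i => (hS _).2 (P.source_C i)
    sink_D := fun j => (hT _).2 (P.sink_D j)
    existsUnique_C := fun c hc => by
      simp only [hsame]
      exact P.existsUnique_C _ (hS' c hc)
    existsUnique_D := fun c hc => by
      simp only [hsame]
      exact P.existsUnique_D _ (hT' c hc) }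

end Transport

/-! ### Trail counts as orbit sums -/

section TrailCounts

theorem Pointing.N_congr {V : Type*} [Quiver V] {m n : ℕ} (P : Pointing V m n)
    (i : Fin m) (j : Fin n) {c c' : ℤ}
    (h : c ≡ c' [ZMOD (Nat.gcd (P.C i).length (P.D j).length : ℕ)]) : P.N i j c = P.N i j c' := by
  have : ∀ a : ℤ, a ≡ c [ZMOD (Nat.gcd (P.C i).length (P.D j).length : ℕ)] ↔
      a ≡ c' [ZMOD (Nat.gcd (P.C i).length (P.D j).length : ℕ)] :=
    fun a => ⟨fun h1 => h1.trans h, fun h1 => h1.trans h.symm⟩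
  simp only [Pointing.N, this]

variable {V : Type*} [Quiver V] [∀ v w : V, Fintype (v ⟶ w)]
  {m n : ℕ} (P : Pointing V m n)

namespace CyclicStructure

/-- The index of the vertex at which all trails from a given source cycle start. -/
theorem exists_base (S : CyclicStructure V) (c : IndexedCycle V) (hc : c.IsSourceCycle) :
    ∃ s : ℤ, ∀ (k : ZMod c.length) (w : V), ¬ OnSourceCycle w → adjMatrix V (c.vertex k) w ≠ 0 →
      k = s := by
  obtain ⟨k, w, hk, hw⟩ := S.exists_trail_from (c.vertex 0) ⟨c, hc, 0, rfl⟩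
  rw [← S.vertex_add_natCast] at hk
  obtain ⟨s, hs⟩ := ZMod.intCast_surjective (0 + (k : ZMod c.length))
  exact ⟨s, fun l w' hw' hl => (S.source_unique c hc _ _ _ _ hw' hw hl hk).trans hs.symm⟩

theorem isTrail_iff (S : CyclicStructure V) (hn : IsNormalForm V) {v w : V} (p : Path v w)
    (hv : OnSourceCycle v) (hw : ¬ OnSourceCycle w) : IsTrail p ↔ ∃ e : v ⟶ w, p = e.toPath := by
  constructor
  · intro h
    have := hn.1 v w p h
    cases p with
    | nil => simp at this
    | cons p e =>
      cases p with
      | nil => exact ⟨e, rfl⟩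
      | cons p e' => simp at this
  · rintro ⟨e, rfl⟩
    exact isTrail_toPath e hv ((S.onSinkCycle_iff w).2 hw)

/-- In normal form the trails are the edges which start at the base point `s` of a source cycle and
end on a sink cycle. -/
theorem N_eq_sum (S : CyclicStructure V) (hn : IsNormalForm V) (i : Fin m) (j : Fin n)
    (c s : ℤ)
    (hs : ∀ (k : ZMod (P.C i).length) (w : V), ¬ OnSourceCycle w →
      adjMatrix V ((P.C i).vertex k) w ≠ 0 → k = s)
    [Fintype (ZMod (P.D j).length)] :
    P.N i j c = ∑ l : ZMod (P.D j).length,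
      if (l.val : ℤ) ≡ c [ZMOD (Nat.gcd (P.C i).length (P.D j).length : ℕ)] then
        adjMatrix V ((P.C i).vertex s) ((P.D j).vertex l) else 0 := by
  have : NeZero (P.C i).length := ⟨(P.C i).length_pos.ne'⟩
  have hC : ∀ k, OnSourceCycle ((P.C i).vertex k) := fun k =>
    (S.isSourceCycle_iff _ k).1 (P.source_C i)
  have hD : ∀ k, ¬ OnSourceCycle ((P.D j).vertex k) := fun k =>
    (S.isSinkCycle_iff _ k).1 (P.sink_D j)
  let f : (Σ (k : ZMod (P.C i).length) (l : {l : ZMod (P.D j).length //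
        (l.val : ℤ) ≡ c [ZMOD (Nat.gcd (P.C i).length (P.D j).length : ℕ)]}),
        ((P.C i).vertex k ⟶ (P.D j).vertex l.1)) →
      {x : Σ (k : ZMod (P.C i).length) (l : ZMod (P.D j).length),
        Path ((P.C i).vertex k) ((P.D j).vertex l) //
        IsTrail x.2.2 ∧ (x.2.1.val : ℤ) ≡ c [ZMOD (Nat.gcd (P.C i).length (P.D j).length : ℕ)]} :=
    fun x => ⟨⟨x.1, x.2.1.1, x.2.2.toPath⟩,
      (S.isTrail_iff hn _ (hC _) (hD _)).2 ⟨x.2.2, rfl⟩, x.2.1.2⟩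
  have hf : Function.Bijective f := by
    constructor
    · rintro ⟨k, ⟨l, hl⟩, e⟩ ⟨k', ⟨l', hl'⟩, e'⟩ h
      have h := congrArg Subtype.val h
      simp only [f, Sigma.mk.injEq] at h
      obtain ⟨rfl, h⟩ := h
      simp only [heq_eq_eq, Sigma.mk.injEq] at h
      obtain ⟨rfl, h⟩ := h
      have := eq_of_heq (Path.hom_heq_of_cons_eq_cons (eq_of_heq h))
      rw [this]
    · rintro ⟨⟨k, l, p⟩, hp, hl⟩
      obtain ⟨e, rfl⟩ : ∃ e : (P.C i).vertex k ⟶ (P.D j).vertex l, p = e.toPath :=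
        (S.isTrail_iff hn p (hC _) (hD _)).1 hp
      exact ⟨⟨k, ⟨l, hl⟩, e⟩, rfl⟩
  rw [Pointing.N, ← Nat.card_eq_of_bijective f hf, Nat.card_sigma,
    Finset.sum_eq_single_of_mem (s : ZMod (P.C i).length) (Finset.mem_univ _)]
  · rw [Nat.card_sigma, ← Finset.sum_filter, Finset.sum_subtype (p := fun l : ZMod (P.D j).length =>
      (l.val : ℤ) ≡ c [ZMOD (Nat.gcd (P.C i).length (P.D j).length : ℕ)]) _ (fun x => by simp)]
    exact Finset.sum_congr rfl fun l _ => by simp [adjMatrix]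
  · intro k _ hk
    rw [Nat.card_sigma]
    refine Finset.sum_eq_zero fun l _ => ?_
    by_contra h
    exact hk (hs k _ (hD l.1) (by simpa [adjMatrix] using h))

theorem length_dvd (S : CyclicStructure V) {L : ℕ} (hL : S.succ ^ L = 1) (c : IndexedCycle V) :
    c.length ∣ L := by
  rw [← ZMod.natCast_eq_zero_iff]
  refine c.vertex_injective ?_
  have := S.vertex_add_natCast c 0 L
  rwa [hL, zero_add] at this

/-- The orbit sum for two vertices on a source cycle and on a sink cycle is a trail count, up to a
factor which depends on the lengths of the cycles only: the two vertices reach the base point and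
the range of a trail at the same time if and only if a congruence modulo the greatest common divisor
of the lengths holds. -/
theorem orbitSum_eq_mul_N (S : CyclicStructure V) (hn : IsNormalForm V) {L : ℕ}
    (hL : S.succ ^ L = 1) (hL0 : 0 < L) (i : Fin m) (j : Fin n) (s : ℤ)
    (hs : ∀ (k : ZMod (P.C i).length) (w : V), ¬ OnSourceCycle w →
      adjMatrix V ((P.C i).vertex k) w ≠ 0 → k = s) (z w : ℤ) :
    orbitSum S.succ L (trailMatrix (adjMatrix V) OnSourceCycle) ((P.C i).vertex z)
      ((P.D j).vertex w) =
      commonMultiples (P.C i).length (P.D j).length L * P.N i j (w - z + s) := by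
  have : NeZero (P.D j).length := ⟨(P.D j).length_pos.ne'⟩
  have hC : ∀ k, OnSourceCycle ((P.C i).vertex k) := fun k =>
    (S.isSourceCycle_iff _ k).1 (P.source_C i)
  have hD : ∀ k, ¬ OnSourceCycle ((P.D j).vertex k) := fun k =>
    (S.isSinkCycle_iff _ k).1 (P.sink_D j)
  have h1 : ∀ r : ℕ, trailMatrix (adjMatrix V) OnSourceCycle ((S.succ ^ r) ((P.C i).vertex z))
      ((S.succ ^ r) ((P.D j).vertex w)) = ∑ l : ZMod (P.D j).length,
        (if (r : ℤ) ≡ s - z [ZMOD (P.C i).length] ∧ (r : ℤ) ≡ l.val - w [ZMOD (P.D j).length]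
          then 1 else 0) * adjMatrix V ((P.C i).vertex s) ((P.D j).vertex l) := by
    intro r
    rw [← S.vertex_add_natCast, ← S.vertex_add_natCast, trailMatrix, Matrix.of_apply,
      if_pos ⟨hC _, hD _⟩, Finset.sum_eq_single_of_mem ((w : ZMod (P.D j).length) + r)
        (Finset.mem_univ _)]
    · have e2 : (r : ℤ) ≡ ((w : ZMod (P.D j).length) + r).val - w [ZMOD (P.D j).length] := by
        rw [← ZMod.intCast_eq_intCast_iff]
        push_cast
        rw [ZMod.natCast_zmod_val]
        ring
      have e1 : (r : ℤ) ≡ s - z [ZMOD (P.C i).length] ↔ (z : ZMod (P.C i).length) + r = s := by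
        rw [← ZMod.intCast_eq_intCast_iff]
        push_cast
        rw [eq_sub_iff_add_eq, add_comm]
      by_cases h : (z : ZMod (P.C i).length) + r = s
      · rw [if_pos ⟨e1.2 h, e2⟩, h, one_mul]
      · rw [if_neg fun hc => h (e1.1 hc.1), zero_mul]
        by_contra hne
        exact h (hs _ _ (hD _) hne)
    · intro l _ hl
      rw [if_neg, zero_mul]
      rintro ⟨-, h⟩
      refine hl ?_
      rw [← ZMod.intCast_eq_intCast_iff] at h
      push_cast at h
      rw [ZMod.natCast_zmod_val] at h
      rw [h]
      ring
  rw [orbitSum, Finset.sum_congr rfl fun r _ => h1 r, Finset.sum_comm,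
    S.N_eq_sum P hn i j _ s hs, Finset.mul_sum]
  refine Finset.sum_congr rfl fun l _ => ?_
  rw [← Finset.sum_mul, sum_ite_modEq_and_modEq (S.length_dvd hL _) (S.length_dvd hL _) hL0]
  have e : (l.val : ℤ) - w ≡ s - z [ZMOD (Nat.gcd (P.C i).length (P.D j).length : ℕ)] ↔
      (l.val : ℤ) ≡ w - z + s [ZMOD (Nat.gcd (P.C i).length (P.D j).length : ℕ)] := by
    rw [Int.modEq_iff_dvd, Int.modEq_iff_dvd]
    ring_nf
  rw [if_congr e rfl rfl]
  split_ifs <;> simp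

end CyclicStructure

end TrailCounts

/-! ### Comparison of the relation ≈ with orbit sums -/

section Comparison

variable {E F : Type*} [Quiver E] [Quiver F] [∀ v w : E, Fintype (v ⟶ w)]
  [∀ v w : F, Fintype (v ⟶ w)]

theorem approx_of_orbitMatch [Finite E] (S : CyclicStructure E) (S' : CyclicStructure F)
    (hE : IsNormalForm E) (hF : IsNormalForm F) {L : ℕ} {φ : E ≃ F}
    (h : OrbitMatch (adjMatrix E) S.succ OnSourceCycle (adjMatrix F) S'.succ OnSourceCycle L φ) :
    Approx E F := by
  obtain ⟨m, n, ⟨P⟩⟩ := S.exists_pointing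
  let Q : Pointing F m n := P.map S S' φ h.map_succ h.src_iff
  choose s hs using fun i => S.exists_base (P.C i) (P.source_C i)
  choose s' hs' using fun i => S'.exists_base (Q.C i) (Q.source_C i)
  refine ⟨m, n, P, Q, fun i => s' i - s i, 0, fun i => rfl, fun j => rfl, fun c i j => ?_⟩
  have h1 := S.orbitSum_eq_mul_N P hE h.pow_left h.period_pos i j (s i) (hs i) (s i) c
  have h2 := S'.orbitSum_eq_mul_N Q hF h.pow_right h.period_pos i j (s' i) (hs' i) (s i) c
  rw [h.orbitSum_eq] at h1
  have h3 := h1.symm.trans h2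
  have h4 := Nat.eq_of_mul_eq_mul_left (commonMultiples_pos h.period_pos) h3
  rw [sub_add_cancel] at h4
  rw [h4]
  congr 1
  simp only [Pi.zero_apply]
  ring

theorem exists_orbitMatch_of_approx [Finite E] [Finite F] (S : CyclicStructure E)
    (S' : CyclicStructure F) (hE : IsNormalForm E) (hF : IsNormalForm F) (h : Approx E F) :
    ∃ L φ, OrbitMatch (adjMatrix E) S.succ OnSourceCycle (adjMatrix F) S'.succ OnSourceCycle
      L φ := by
  obtain ⟨m, n, P, Q, a, b, hp, hq, hN⟩ := h
  choose s hs using fun i => S.exists_base (P.C i) (P.source_C i)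
  choose s' hs' using fun i => S'.exists_base (Q.C i) (Q.source_C i)
  have hNZ : ∀ (c : ℤ) (i : Fin m) (j : Fin n), P.N i j c = Q.N i j (c + a i + b j) := by
    intro c i j
    set g : ℕ := Nat.gcd (P.C i).length (P.D j).length with hg
    have hg0 : (g : ℤ) ≠ 0 := by
      exact_mod_cast (Nat.gcd_pos_of_pos_left _ (P.C i).length_pos).ne'
    have hc : ((c % g).toNat : ℤ) ≡ c [ZMOD g] := by
      rw [Int.toNat_of_nonneg (Int.emod_nonneg _ hg0)]
      exact Int.mod_modEq _ _
    rw [← P.N_congr i j hc, hN]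
    refine Q.N_congr i j ?_
    rw [← hp, ← hq]
    exact (hc.add_right _).add_right _
  obtain ⟨φ, hφ⟩ := exists_equiv_of_partition P.cycle Q.cycle
    (by rintro (i | j); exacts [hp i, hq j]) (S.existsUnique_cycle P) (S'.existsUnique_cycle Q)
    (Sum.elim (fun i => s' i - s i - a i) b)
  have hcov : ∀ v : E, ∃ (x : Fin m ⊕ Fin n) (z : ℤ), v = (P.cycle x).vertex z := by
    intro v
    obtain ⟨x, ⟨k, rfl⟩, -⟩ := S.existsUnique_cycle P v
    obtain ⟨z, rfl⟩ := ZMod.intCast_surjective k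
    exact ⟨x, z, rfl⟩
  have hPC : ∀ i k, OnSourceCycle ((P.C i).vertex k) := fun i k =>
    (S.isSourceCycle_iff _ k).1 (P.source_C i)
  have hPD : ∀ j k, ¬ OnSourceCycle ((P.D j).vertex k) := fun j k =>
    (S.isSinkCycle_iff _ k).1 (P.sink_D j)
  have hQC : ∀ i k, OnSourceCycle ((Q.C i).vertex k) := fun i k =>
    (S'.isSourceCycle_iff _ k).1 (Q.source_C i)
  have hQD : ∀ j k, ¬ OnSourceCycle ((Q.D j).vertex k) := fun j k =>
    (S'.isSinkCycle_iff _ k).1 (Q.sink_D j)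
  have hsrc : ∀ v, OnSourceCycle (φ v) ↔ OnSourceCycle v := by
    intro v
    obtain ⟨x, z, rfl⟩ := hcov v
    rw [hφ]
    rcases x with i | j
    · exact iff_of_true (hQC i _) (hPC i _)
    · exact iff_of_false (hQD j _) (hPD j _)
  have hL0 : 0 < orderOf S.succ * orderOf S'.succ := Nat.mul_pos (orderOf_pos _) (orderOf_pos _)
  have hL : S.succ ^ (orderOf S.succ * orderOf S'.succ) = 1 := by
    rw [pow_mul, pow_orderOf_eq_one, one_pow]
  have hL' : S'.succ ^ (orderOf S.succ * orderOf S'.succ) = 1 := by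
    rw [mul_comm, pow_mul, pow_orderOf_eq_one, one_pow]
  refine ⟨orderOf S.succ * orderOf S'.succ, φ, hL0, hL, hL', ?_, hsrc, ?_⟩
  · intro v
    obtain ⟨x, z, rfl⟩ := hcov v
    have h1 : S.succ ((P.cycle x).vertex z) = (P.cycle x).vertex ((z + 1 : ℤ)) := by
      rw [← S.vertex_add_one]; push_cast; rfl
    rw [h1, hφ, hφ, ← S'.vertex_add_one, add_right_comm]
    push_cast
    rfl
  · intro u v
    by_cases huv : OnSourceCycle u ∧ ¬ OnSourceCycle v
    · obtain ⟨x, z, rfl⟩ := hcov u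
      obtain ⟨y, w, rfl⟩ := hcov v
      rcases x with i | j'
      · rcases y with i' | j
        · exact absurd (hPC i' _) huv.2
        · rw [hφ, hφ]
          refine (S.orbitSum_eq_mul_N P hE hL hL0 i j (s i) (hs i) z w).trans ?_
          refine Eq.trans ?_ (S'.orbitSum_eq_mul_N Q hF hL' hL0 i j (s' i) (hs' i) _ _).symm
          rw [hNZ, hp, hq]
          congr 2
          simp only [Sum.elim_inl, Sum.elim_inr]
          ring
      · exact absurd huv.1 (hPD j' _)
    · rw [orbitSum_trailMatrix_eq_zero S.isSplit.src_iff huv,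
        orbitSum_trailMatrix_eq_zero S'.isSplit.src_iff (by rwa [hsrc, hsrc])]

end Comparison

end GraphDyn

theorem theorem3p10 (K : Type*) [Field K]
    (E : Type*) [Quiver E] [Fintype E] [∀ v w : E, Fintype (v ⟶ w)]
    (F : Type*) [Quiver F] [Fintype F] [∀ v w : F, Fintype (v ⟶ w)]
    (hE : GraphDyn.IsGKDimThree K E) (hF : GraphDyn.IsGKDimThree K F)
    (hEn : GraphDyn.IsNormalForm E) (hFn : GraphDyn.IsNormalForm F) :
    GraphDyn.StrongShiftEquiv (GraphDyn.adjMatrix E) (GraphDyn.adjMatrix F) ↔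
      GraphDyn.Approx E F := by
  obtain ⟨S⟩ := hE.nonempty_cyclicStructure K E hEn
  obtain ⟨S'⟩ := hF.nonempty_cyclicStructure K F hFn
  constructor
  · intro h
    obtain ⟨L, φ, hφ⟩ := GraphDyn.exists_orbitMatch_of_strongShiftEquiv S.isSplit S'.isSplit
      S.exists_trail_from S.exists_trail_to h
    exact GraphDyn.approx_of_orbitMatch S S' hEn hFn hφ
  · intro h
    obtain ⟨L, φ, hφ⟩ := GraphDyn.exists_orbitMatch_of_approx S S' hEn hFn h
    exact hφ.strongShiftEquiv S.isSplit S'.isSplit
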